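/- Let $0\le m<d$, $p=d-m$, and let $h_1,\dots,h_m,g_1,\dots,g_\ell:\mathbb{R}^d\to\mathbb{R}$ be differentiable with Lipschitz continuous gradients. Let $\Sigma=\{x\in\mathbb{R}^d: h(x)=0,\ g(x)\le 0\}$ be bounded, and assume LICQ: for every $x\in\Sigma$ the gradients $\nabla h_j(x)$ (all $j$) and $\nabla g_i(x)$ (all $i$ with $g_i(x)=0$) are linearly independent. Suppose that $\Sigma$ has finitely many connected components $\Sigma_1,\dots,\Sigma_C$. Let $\mu$ be the $p$-dimensional Hausdorff measure (normalized to be Lebesgue measure on $p$-dimensional subspaces), $\sigma_c=\mu(\Sigma_c)$, $S=\mu(\Sigma)$, $\alpha^*_c=\sigma_c/S$, let $u_c$ be the uniform distribution $\sigma_c^{-1}\mu|_{\Sigma_c}$, and let $V_p$ be the volume of the unit ball of $\mathbb{R}^p$. For each $N$ consider a random configuration of $N$ particles in which particle $i$ lies in the component $\Sigma_{c_N(i)}$, and assume that $N_c/N\to\alpha_c>0$ for every $c$, where $N_c=\#\{i: c_N(i)=c\}$ and $\sum_c\alpha_c=1$. Let $x_1,\dots,x_N$ be the particles obtained by moving every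 particle independently by $M_N$ steps of a Markov kernel $K$. Assume mixing rejuvenation: $u_cK=u_c$ for every $c$, and the total variation distance between the joint law of $(x_1,\dots,x_N)$ and the product law $\bigotimes_{i=1}^N u_{c_N(i)}$ tends to $0$ as $N\to\infty$. Let $k_N\to\infty$ with $k_N/N\to0$, let $\varepsilon_{i,k}$ be the Euclidean distance from $x_i$ to its $k$-th nearest neighbour among $\{x_j\}_{j\ne i}$, let $\tau>0$, $\beta=\tau/p$, $w_i=\varepsilon_{i,k_N}^\tau/\sum_j\varepsilon_{j,k_N}^\tau$, and $$(\Phi\alpha)_c=\frac{\alpha_c^{1-\beta}(\alpha_c^*)^\beta}{\sum_{j=1}^C\alpha_j^{1-\beta}(\alpha_j^*)^\beta}.$$ Then for every component $c$ and every $\eta>0$, as $N\to\infty$: 1. the $k$-NN radius of a particle of component $c$ concentrates at $\bigl(k_N\sigma_c/(N V_p\alpha_c)\bigr)^{1/p}$: $$\max_{i:\,c_N(i)=c}\ \mathbb{P}\left(\left|\frac{\varepsilon_{i,k_N}}{\bigl(k_N\sigma_c/(N V_p\alpha_c)\bigr)^{1/p}}-1\right|\ge\eta\right)\to0;$$ 2.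 resampling with the weights $w_i$ induces the map $\Phi$: the weight $\sum_{i:\,x_i\in\Sigma_c}w_i$ of the component $c$ converges to $(\Phi\alpha)_c$ in probability, and if $N$ particles are drawn independently from $x_1,\dots,x_N$ with probabilities $w_1,\dots,w_N$, then the fraction of them that lies in $\Sigma_c$ also converges to $(\Phi\alpha)_c$ in probability. -/

import Mathlib

open MeasureTheory ProbabilityTheory Filter Topology
open scoped NNReal ENNReal

noncomputable section

namespace MASEM

/-! ### The feasible set, its components and its volume measure -/

/-- The feasible set `{x ∈ ℝ^d | h x = 0, g x ≤ 0}`. -/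
def feasibleSet {d m l : ℕ} (h : Fin m → EuclideanSpace ℝ (Fin d) → ℝ)
    (g : Fin l → EuclideanSpace ℝ (Fin d) → ℝ) : Set (EuclideanSpace ℝ (Fin d)) :=
  {x | (∀ j, h j x = 0) ∧ ∀ i, g i x ≤ 0}

/-- A constraint function: differentiable, with Lipschitz continuous gradient. -/
def IsSmoothConstraint {d : ℕ} (f : EuclideanSpace ℝ (Fin d) → ℝ) : Prop :=
  Differentiable ℝ f ∧ ∃ L : ℝ≥0, LipschitzWith L (gradient f)

/-- Linear independence constraint qualification: at every feasible point the gradients of all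
equality constraints and of the active inequality constraints form a linearly independent family. -/
def LICQ {d m l : ℕ} (h : Fin m → EuclideanSpace ℝ (Fin d) → ℝ)
    (g : Fin l → EuclideanSpace ℝ (Fin d) → ℝ) : Prop :=
  ∀ x ∈ feasibleSet h g, LinearIndependent ℝ
    (Sum.elim (fun j : Fin m => gradient (h j) x)
      (fun i : {i : Fin l // g i x = 0} => gradient (g i.1) x))

/-- `comp 0, …, comp (C - 1)` are the distinct connected components of `S`, and there are no
others. -/
structure IsComponentDecomposition {X : Type*} [TopologicalSpace X] (S : Set X) {C : ℕ}
    (comp : Fin C → Set X) : Prop where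
  eq_component : ∀ c, ∃ x ∈ S, comp c = connectedComponentIn S x
  disjoint : Pairwise fun a b => Disjoint (comp a) (comp b)
  iUnion_eq : ⋃ c, comp c = S

/-- The `p`-dimensional volume of a set in `ℝ^d`: the `p`-dimensional Hausdorff measure, normalized
so that it is Lebesgue measure on `p`-dimensional subspaces. -/
def vol {d : ℕ} (p : ℕ) (A : Set (EuclideanSpace ℝ (Fin d))) : ℝ :=
  (Measure.euclideanHausdorffMeasure p : Measure (EuclideanSpace ℝ (Fin d))).real A

/-- The uniform distribution on a set `A` with respect to `p`-dimensional volume. -/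
def uniformOn {d : ℕ} (p : ℕ) (A : Set (EuclideanSpace ℝ (Fin d))) :
    Measure (EuclideanSpace ℝ (Fin d)) :=
  ProbabilityTheory.cond (Measure.euclideanHausdorffMeasure p) A

/-- The volume `V_p` of the unit ball of `ℝ^p`. -/
def unitBallVol (p : ℕ) : ℝ :=
  (volume : Measure (EuclideanSpace ℝ (Fin p))).real (Metric.ball 0 1)

/-! ### Nearest neighbour radii, weights and resampling -/

/-- The distance from `x i` to its `k`-th nearest neighbour among the `x j` with `j ≠ i`:
the smallest radius `r` such that the closed ball around `x i` holds at least `k` of them. -/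
def knnRadius {E : Type*} [PseudoMetricSpace E] {N : ℕ} (k : ℕ) (x : Fin N → E) (i : Fin N) : ℝ :=
  sInf {r : ℝ | 0 ≤ r ∧ k ≤ Nat.card {j : Fin N // j ≠ i ∧ dist (x i) (x j) ≤ r}}

/-- The normalized resampling weights `w_i = ε_{i,k}^τ / ∑_j ε_{j,k}^τ`. -/
def weight {E : Type*} [PseudoMetricSpace E] {N : ℕ} (k : ℕ) (τ : ℝ) (x : Fin N → E)
    (i : Fin N) : ℝ :=
  knnRadius k x i ^ τ / ∑ j, knnRadius k x j ^ τ

/-- The total weight of the particles lying in `A`. -/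
def weightMass {E : Type*} [PseudoMetricSpace E] {N : ℕ} (k : ℕ) (τ : ℝ) (x : Fin N → E)
    (A : Set E) : ℝ :=
  ∑ i, A.indicator (fun _ => weight k τ x i) (x i)

/-- The law of the `N` ancestor indices in the resampling step, given the particles `x`:
they are drawn independently, each equal to `i` with probability `w_i`. -/
def resampleLaw {E : Type*} [PseudoMetricSpace E] {N : ℕ} (k : ℕ) (τ : ℝ) (x : Fin N → E) :
    Measure (Fin N → Fin N) :=
  Measure.pi fun _ => ∑ i, ENNReal.ofReal (weight k τ x i) • Measure.dirac i

/-- The fraction of the particles `x` that lie in `A`. -/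
def fraction {E : Type*} {N : ℕ} (x : Fin N → E) (A : Set E) : ℝ :=
  (Nat.card {i : Fin N // x i ∈ A} : ℝ) / N

/-- The mean-field resampling map
`(Φ α)_c = α_c^(1-β) (α*_c)^β / ∑_j α_j^(1-β) (α*_j)^β`. -/
def meanFieldMap {C : ℕ} (β : ℝ) (αstar α : Fin C → ℝ) (c : Fin C) : ℝ :=
  α c ^ (1 - β) * αstar c ^ β / ∑ j, α j ^ (1 - β) * αstar j ^ β

/-! ### Rejuvenation -/

/-- The total variation distance of two probability measures. -/
def tvDist {X : Type*} [MeasurableSpace X] (μ ν : Measure X) : ℝ≥0∞ :=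
  ⨆ s : Set X, ⨆ _ : MeasurableSet s, ENNReal.ofReal |μ.real s - ν.real s|

instance isMarkovKernel_pow {X : Type*} [MeasurableSpace X] (K : Kernel X X) [IsMarkovKernel K]
    (M : ℕ) : IsMarkovKernel (K ^ M) := by
  induction M with
  | zero => exact inferInstanceAs (IsMarkovKernel Kernel.id)
  | succ n ih => rw [pow_succ]; exact inferInstanceAs (IsMarkovKernel ((K ^ n) ∘ₖ K))

/-- The kernel that moves every particle of a configuration independently by `K`. -/
def particleKernel {X : Type*} [MeasurableSpace X] (K : Kernel X X) [IsMarkovKernel K] (N : ℕ) :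
    Kernel (Fin N → X) (Fin N → X) where
  toFun y := Measure.pi fun i => K (y i)
  measurable' := by
    refine Measurable.measure_of_isPiSystem_of_isProbabilityMeasure generateFrom_pi.symm
      isPiSystem_pi ?_
    rintro _ ⟨s, hs, rfl⟩
    simp only [Measure.pi_pi]
    refine Finset.measurable_prod _ fun i _ => ?_
    exact (Kernel.measurable_coe K (hs i (Set.mem_univ i))).comp (measurable_pi_apply i)

/-- The law of the `N` particles after `M` steps of the kernel `K` have been applied independently
to each particle of a configuration with law `ν`. -/
def rejuvenatedLaw {X : Type*} [MeasurableSpace X] (K : Kernel X X) [IsMarkovKernel K] (M : ℕ)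
    {N : ℕ} (ν : Measure (Fin N → X)) : Measure (Fin N → X) :=
  ν.bind (particleKernel (K ^ M) N)

/-- Mixing rejuvenation, for a sequence of particle systems indexed by the number `N` of particles.
Before rejuvenation the system has law `ν N`, and particle `i` lies in the component
`comp (lab N i)`; then `M N` steps of `K` are applied to every particle.
The kernel leaves each uniform distribution `u_c` on a component invariant, and the rejuvenated
particles are approximately independent with law `u_c` for every particle of component `c`:
the total variation distance of the joint laws tends to zero. -/
structure MixingRejuvenation {d C : ℕ} (p : ℕ) (comp : Fin C → Set (EuclideanSpace ℝ (Fin d)))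
    (K : Kernel (EuclideanSpace ℝ (Fin d)) (EuclideanSpace ℝ (Fin d))) [IsMarkovKernel K]
    (M : ℕ → ℕ) (lab : ∀ N : ℕ, Fin N → Fin C)
    (ν : ∀ N : ℕ, Measure (Fin N → EuclideanSpace ℝ (Fin d))) : Prop where
  invariant : ∀ c, Kernel.Invariant K (uniformOn p (comp c))
  start_mem : ∀ N, ∀ᵐ y ∂ν N, ∀ i, y i ∈ comp (lab N i)
  mixes : Tendsto (fun N => tvDist (rejuvenatedLaw K (M N) (ν N))
    (Measure.pi fun i => uniformOn p (comp (lab N i)))) atTop (𝓝 0)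

end MASEM

end

/-! Total variation controls every event uniformly, so it suffices to treat independent particles
with laws `u_c`; the rejuvenated system then differs by an error that tends to zero.

Geometry. Near a feasible point, chords of the level set of `h` are almost tangent, and the level
set projects onto a neighbourhood in the tangent space. Volumes are therefore compared with those of
`p`-dimensional balls by Lipschitz maps. This gives density `V_p` at points without active
inequalities (`tendsto_volume_density`). Points with an active inequality lie on sets of dimension
`p - 1` and are null. LICQ supplies a direction pointing inwards for all active constraints, so even
at the boundary a ball of radius `r` has volume at least `c * r ^ p`, uniformly
(`exists_lower_volume_bound`). `IsUniformFamily` retains just these facts.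

Radii. Given `x_i = a`, the number of neighbours within a small `r` is a sum of independent
indicators with mean about `N α_c u_c(B(a, r))`. At `ρ` times the claimed radius this mean is about
`ρ ^ p * k_N`. As `k_N → ∞`, Chernoff bounds force the count below `k_N` for `ρ < 1` and above it
for `ρ > 1`; dominated convergence averages over `a` (`tendsto_chernoffBound`).

Weights. The uniform volume bound gives exponential tails for the rescaled radii, hence bounded
moments, so their `τ`-th powers converge to `1` in `L¹`. Markov's inequality gives convergence of
the component averages, in spite of the dependence between radii. The weight of component `c`
becomes proportional to `α_c (σ_c / α_c) ^ β`, which is `Φ` after normalization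
(`tendsto_pi_weightMass`). Given the particles, resampling adds a multinomial fluctuation that
Chebyshev's inequality controls. -/

noncomputable section

set_option linter.unusedSectionVars false

namespace MASEM

/-! ### Tangent spaces of level sets. -/

section Tangent

variable {E : Type*} [NormedAddCommGroup E] [InnerProductSpace ℝ E] [FiniteDimensional ℝ E]
  {ι : Type*} [Fintype ι]

/-- The space of vectors orthogonal to all members of a family. -/
def tangent (a : ι → E) : Submodule ℝ E := (Submodule.span ℝ (Set.range a))ᗮ

theorem inner_eq_zero_of_mem_tangent {a : ι → E} {t : E} (ht : t ∈ tangent a) (j : ι) :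
    inner ℝ (a j) t = 0 :=
  ht _ (Submodule.subset_span ⟨j, rfl⟩)

theorem finrank_tangent {a : ι → E} (ha : LinearIndependent ℝ a) :
    Module.finrank ℝ (tangent a) = Module.finrank ℝ E - Fintype.card ι := by
  have h1 := (Submodule.span ℝ (Set.range a)).finrank_add_finrank_orthogonal
  have h2 := finrank_span_eq_card ha
  unfold tangent
  omega

/-- The residual is the component of `v` in the span of `a`, where the map `v ↦ (⟨a j, v⟩)` is
injective, hence bounded below in finite dimension. -/
theorem exists_mul_norm_sub_starProjection_le (a : ι → E) : ∃ c : ℝ, 0 < c ∧ ∀ v : E,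
    c * ‖v - (tangent a).starProjection v‖ ≤ ‖fun j => inner ℝ (a j) v‖ := by
  set V := Submodule.span ℝ (Set.range a)
  let L : E →ₗ[ℝ] (ι → ℝ) := LinearMap.pi fun j => (innerSL ℝ (a j)).toLinearMap
  have hker : LinearMap.ker (L.comp V.subtype) = ⊥ := by
    rw [LinearMap.ker_eq_bot']
    intro v hv
    have h1 : (v : E) ∈ Vᗮ := by
      refine (Submodule.mem_orthogonal _ _).2 fun u hu => ?_
      induction hu using Submodule.span_induction with
      | mem x hx => obtain ⟨j, rfl⟩ := hx; exact congrFun hv j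
      | zero => simp
      | add x y _ _ hx hy => simp [inner_add_left, hx, hy]
      | smul r x _ hx => simp [inner_smul_left, hx]
    have h2 : (v : E) ∈ V ⊓ Vᗮ := ⟨v.2, h1⟩
    rw [Submodule.inf_orthogonal_eq_bot] at h2
    exact Subtype.ext ((Submodule.mem_bot ℝ).1 h2)
  obtain ⟨K, hK, hanti⟩ := (L.comp V.subtype).exists_antilipschitzWith hker
  refine ⟨(K : ℝ)⁻¹, by positivity, fun v => ?_⟩
  have h1 : v - (tangent a).starProjection v = V.starProjection v := by
    have := V.starProjection_add_starProjection_orthogonal v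
    rw [tangent, sub_eq_iff_eq_add]
    exact this.symm
  have h2 : (fun j => inner ℝ (a j) v) = L.comp V.subtype (V.orthogonalProjectionOnto v) := by
    funext j
    change inner ℝ (a j) v = inner ℝ (a j) (V.starProjection v)
    rw [← h1, inner_sub_right, inner_eq_zero_of_mem_tangent (Submodule.starProjection_apply_mem _ _),
      sub_zero]
  have h3 := hanti.le_mul_dist (V.orthogonalProjectionOnto v) 0
  rw [map_zero, dist_zero_right, dist_zero_right] at h3
  rw [h2, h1, inv_mul_le_iff₀ (by positivity)]
  exact h3

/-- Chords of a level set are almost tangent: strict differentiability makes `⟨a j, q.1 - q.2⟩`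
small relative to the chord, and these inner products control its normal component. -/
theorem eventually_norm_sub_starProjection_le {f : ι → E → ℝ} {a : ι → E} {x₀ : E}
    (hf : ∀ j, HasStrictFDerivAt (f j) (innerSL ℝ (a j)) x₀) {δ : ℝ} (hδ : 0 < δ) :
    ∀ᶠ q : E × E in 𝓝 (x₀, x₀), (∀ j, f j q.1 = f j q.2) →
      ‖(q.1 - q.2) - (tangent a).starProjection (q.1 - q.2)‖ ≤ δ * ‖q.1 - q.2‖ := by
  obtain ⟨c, hc, hle⟩ := exists_mul_norm_sub_starProjection_le a
  have h1 : ∀ᶠ q : E × E in 𝓝 (x₀, x₀), ∀ j,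
      ‖f j q.1 - f j q.2 - innerSL ℝ (a j) (q.1 - q.2)‖ ≤ (c * δ) * ‖q.1 - q.2‖ := by
    rw [eventually_all]
    exact fun j => (hf j).isLittleO.def (by positivity)
  filter_upwards [h1] with q hq heq
  have h2 := hle (q.1 - q.2)
  have h3 : ‖fun j => inner ℝ (a j) (q.1 - q.2)‖ ≤ (c * δ) * ‖q.1 - q.2‖ := by
    rw [pi_norm_le_iff_of_nonneg (by positivity)]
    intro j
    have := hq j
    rwa [heq j, sub_self, zero_sub, norm_neg] at this
  have h4 := h2.trans h3
  rw [mul_assoc] at h4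
  exact le_of_mul_le_mul_left h4 hc

/-- Independence allows a functional to be prescribed on the span; it is extended to `E` and
represented by a vector. -/
theorem exists_inner_eq {a : ι → E} (ha : LinearIndependent ℝ a) (b : ι → ℝ) :
    ∃ v : E, ∀ j, inner ℝ (a j) v = b j := by
  let B := Module.Basis.span ha
  obtain ⟨φ, hφ⟩ := (B.constr ℝ b).exists_extend
  refine ⟨(InnerProductSpace.toDual ℝ E).symm (LinearMap.toContinuousLinearMap φ), fun j => ?_⟩
  rw [real_inner_comm, InnerProductSpace.toDual_symm_apply]
  have h1 := LinearMap.congr_fun hφ (B j)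
  rw [Module.Basis.constr_basis] at h1
  rw [← h1]
  simp [B, Module.Basis.span_apply]

/-- Near a regular point, the level sets of `f` project onto a uniform neighbourhood in the
tangent space. -/
theorem eventually_exists_starProjection_eq {f : ι → E → ℝ} {a : ι → E} {x₀ : E}
    (hf : ∀ j, HasStrictFDerivAt (f j) (innerSL ℝ (a j)) x₀) (ha : LinearIndependent ℝ a)
    {U : Set E} (hU : U ∈ 𝓝 x₀) : ∃ ρ > 0, ∀ᶠ x in 𝓝 x₀, ∀ t ∈ tangent a, ‖t‖ ≤ ρ →
      ∃ z ∈ U, (∀ j, f j z = f j x) ∧ (tangent a).starProjection (z - x) = t := by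
  set T := tangent a
  -- Pairing `f` with the tangential projection gives a map with surjective derivative at `x₀`,
  -- hence one that maps neighbourhoods of `x₀` onto neighbourhoods of `F x₀`.
  let F : E → (ι → ℝ) × T := fun z => (fun j => f j z, T.orthogonalProjectionOnto z)
  let F' : E →L[ℝ] (ι → ℝ) × T :=
    (ContinuousLinearMap.pi fun j => innerSL ℝ (a j)).prod T.orthogonalProjectionOnto
  have hF : HasStrictFDerivAt F F' x₀ :=
    (hasStrictFDerivAt_pi.2 hf).prodMk T.orthogonalProjectionOnto.hasStrictFDerivAt
  have hsurj : F'.range = ⊤ := by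
    rw [LinearMap.range_eq_top]
    rintro ⟨b, t⟩
    obtain ⟨v, hv⟩ := exists_inner_eq ha b
    refine ⟨v - T.starProjection v + t, Prod.ext (funext fun j => ?_) ?_⟩
    · change inner ℝ (a j) (v - T.starProjection v + t) = b j
      rw [inner_add_right, inner_sub_right, inner_eq_zero_of_mem_tangent t.2,
        inner_eq_zero_of_mem_tangent (Submodule.starProjection_apply_mem _ _), hv]
      ring
    · change T.orthogonalProjectionOnto (v - T.starProjection v + t) = t
      rw [map_add, map_sub, Submodule.orthogonalProjectionOnto_mem_subspace_eq_self, add_eq_right,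
        sub_eq_zero]
      exact (Submodule.orthogonalProjectionOnto_mem_subspace_eq_self
        (T.orthogonalProjectionOnto v)).symm
  have hmap := hF.map_nhds_eq_of_surj hsurj
  have h1 : F '' U ∈ 𝓝 (F x₀) := hmap ▸ image_mem_map hU
  obtain ⟨ρ, hρ, hball⟩ := Metric.mem_nhds_iff.1 h1
  refine ⟨ρ / 3, by positivity, ?_⟩
  filter_upwards [hF.continuousAt.preimage_mem_nhds (Metric.ball_mem_nhds (F x₀)
    (show 0 < ρ / 3 by positivity))] with x hx t ht htρ
  have h2 : F x + (0, ⟨t, ht⟩) ∈ Metric.ball (F x₀) ρ := by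
    rw [Metric.mem_ball]
    have h3 : dist (F x + (0, ⟨t, ht⟩)) (F x) ≤ ρ / 3 := by
      rw [dist_eq_norm, add_sub_cancel_left, Prod.norm_def]
      simpa using htρ
    have h4 : dist (F x) (F x₀) < ρ / 3 := hx
    linarith [dist_triangle (F x + (0, ⟨t, ht⟩)) (F x) (F x₀)]
  obtain ⟨z, hzU, hz⟩ := hball h2
  refine ⟨z, hzU, fun j => ?_, ?_⟩
  · have := congrFun (congrArg Prod.fst hz) j
    simpa [F] using this
  · have h5 : T.orthogonalProjectionOnto z = T.orthogonalProjectionOnto x + ⟨t, ht⟩ :=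
      congrArg Prod.snd hz
    rw [Submodule.starProjection_apply, map_sub, h5]
    simp

end Tangent

/-! ### Hausdorff measure under orthogonal projection. -/

section Hausdorff

variable {E : Type*} [NormedAddCommGroup E] [InnerProductSpace ℝ E] [FiniteDimensional ℝ E]
  [MeasurableSpace E] [BorelSpace E]

theorem euclideanHausdorffMeasure_image_le {X Y : Type*} [EMetricSpace X] [MeasurableSpace X]
    [BorelSpace X] [EMetricSpace Y] [MeasurableSpace Y] [BorelSpace Y] {f : X → Y} {K : ℝ≥0}
    {s : Set X} (hf : LipschitzOnWith K f s) (n : ℕ) :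
    (Measure.euclideanHausdorffMeasure n : Measure Y) (f '' s) ≤
      (K : ℝ≥0∞) ^ n * (Measure.euclideanHausdorffMeasure n : Measure X) s := by
  simp only [Measure.euclideanHausdorffMeasure_def, Measure.smul_apply]
  have := hf.hausdorffMeasure_image_le (d := n) (by positivity)
  rw [ENNReal.rpow_natCast] at this
  rw [mul_smul_comm]
  gcongr

theorem euclideanHausdorffMeasure_closedBall (n : ℕ) (hn : Module.finrank ℝ E = n) (x : E) {r : ℝ}
    (hr : 0 ≤ r) : (Measure.euclideanHausdorffMeasure n : Measure E) (Metric.closedBall x r) =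
      ENNReal.ofReal (r ^ n * unitBallVol n) := by
  subst hn
  have e := (stdOrthonormalBasis ℝ E).repr
  rw [← e.isometry.euclideanHausdorffMeasure_image, e.image_closedBall,
    EuclideanSpace.euclideanHausdorffMeasure_eq_volume, Measure.addHaar_closedBall _ _ hr,
    ENNReal.ofReal_mul (by positivity), unitBallVol, Measure.real, ENNReal.ofReal_toReal]
  · simp
  · exact measure_ball_lt_top.ne

/-- On `A` the projection is injective and its inverse is `κ⁻¹`-Lipschitz. -/
theorem euclideanHausdorffMeasure_le_of_projection (T : Submodule ℝ E) {A : Set E} {κ : ℝ≥0}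
    (hκ : κ ≠ 0) (hA : ∀ y ∈ A, ∀ z ∈ A, κ * ‖y - z‖ ≤ ‖T.starProjection (y - z)‖) (n : ℕ) :
    (Measure.euclideanHausdorffMeasure n : Measure E) A ≤ ((κ⁻¹ : ℝ≥0) : ℝ≥0∞) ^ n *
      (Measure.euclideanHausdorffMeasure n : Measure T) (T.orthogonalProjectionOnto '' A) := by
  rcases A.eq_empty_or_nonempty with rfl | ⟨x, hx⟩
  · simp
  have : Nonempty E := ⟨x⟩
  set P := T.orthogonalProjectionOnto
  have hκ' : (0 : ℝ) < κ := by positivity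
  have hbd : ∀ y ∈ A, ∀ z ∈ A, dist y z ≤ (κ : ℝ)⁻¹ * dist (P y) (P z) := by
    intro y hy z hz
    rw [dist_eq_norm, dist_eq_norm, ← map_sub, ← div_eq_inv_mul, le_div_iff₀ hκ', mul_comm]
    exact hA y hy z hz
  have hinj : Set.InjOn P A := by
    intro y hy z hz hyz
    have := hbd y hy z hz
    rw [hyz, dist_self, mul_zero] at this
    exact dist_le_zero.1 this
  have hinv : Function.invFunOn P A '' (P '' A) = A := by
    rw [Set.image_image]
    exact (Set.image_congr fun y hy => hinj.leftInvOn_invFunOn hy).trans (Set.image_id' A)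
  have hlip : LipschitzOnWith κ⁻¹ (Function.invFunOn P A) (P '' A) := by
    refine LipschitzOnWith.of_dist_le_mul ?_
    rintro _ ⟨y, hy, rfl⟩ _ ⟨z, hz, rfl⟩
    rw [hinj.leftInvOn_invFunOn hy, hinj.leftInvOn_invFunOn hz]
    simpa using hbd y hy z hz
  have := euclideanHausdorffMeasure_image_le hlip n
  rwa [hinv] at this

theorem euclideanHausdorffMeasure_projection_le (T : Submodule ℝ E) (A : Set E) (n : ℕ) :
    (Measure.euclideanHausdorffMeasure n : Measure T) (T.orthogonalProjectionOnto '' A) ≤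
      (Measure.euclideanHausdorffMeasure n : Measure E) A := by
  simpa using euclideanHausdorffMeasure_image_le
    (T.lipschitzWith_orthogonalProjectionOnto.lipschitzOnWith (s := A)) n

end Hausdorff

/-- Only the continuity of the gradient matters here: it upgrades differentiability to strict
differentiability. -/
theorem IsSmoothConstraint.hasStrictFDerivAt {d : ℕ} {f : EuclideanSpace ℝ (Fin d) → ℝ}
    (hf : IsSmoothConstraint f) (x : EuclideanSpace ℝ (Fin d)) :
    HasStrictFDerivAt f (innerSL ℝ (gradient f x)) x := by
  obtain ⟨hd, L, hL⟩ := hf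
  refine hasStrictFDerivAt_of_hasFDerivAt_of_continuousAt (f' := fun y => innerSL ℝ (gradient f y))
    (Eventually.of_forall fun y => ?_) ?_
  · exact (hd y).hasGradientAt.hasFDerivAt
  · exact ((innerSL ℝ).continuous.comp hL.continuous).continuousAt

theorem unitBallVol_pos (p : ℕ) : 0 < unitBallVol p :=
  ENNReal.toReal_pos (Metric.measure_ball_pos _ _ one_pos).ne' measure_ball_lt_top.ne

theorem mul_norm_le_of_norm_sub_le {E : Type*} [NormedAddCommGroup E] {δ : ℝ} {v w : E}
    (h : ‖v - w‖ ≤ δ * ‖v‖) : (1 - δ) * ‖v‖ ≤ ‖w‖ := by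
  have := norm_sub_norm_le v w
  linarith

/-! ### Volume of level sets near a regular point. -/

section LevelSet

variable {E : Type*} [NormedAddCommGroup E] [InnerProductSpace ℝ E] [FiniteDimensional ℝ E]
  {ι : Type*} [Fintype ι] {f : ι → E → ℝ} {a : ι → E} {x₀ : E}

theorem exists_nhds_norm_sub_starProjection_le
    (hf : ∀ j, HasStrictFDerivAt (f j) (innerSL ℝ (a j)) x₀) {δ : ℝ} (hδ : 0 < δ) :
    ∃ U ∈ 𝓝 x₀, ∀ y ∈ U, ∀ z ∈ U, (∀ j, f j y = f j z) →
      ‖(y - z) - (tangent a).starProjection (y - z)‖ ≤ δ * ‖y - z‖ := by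
  have h := eventually_norm_sub_starProjection_le hf hδ
  rw [nhds_prod_eq] at h
  obtain ⟨U, hU, hsub⟩ := mem_prod_same_iff.1 h
  exact ⟨U, hU, fun y hy z hz => hsub (Set.mk_mem_prod hy hz)⟩

/-- Local charts of level sets over the tangent space. -/
theorem exists_chart (hf : ∀ j, HasStrictFDerivAt (f j) (innerSL ℝ (a j)) x₀)
    (ha : LinearIndependent ℝ a) {δ : ℝ} (hδ : 0 < δ) {W : Set E} (hW : W ∈ 𝓝 x₀) :
    ∃ ρ > 0, ∀ᶠ x in 𝓝 x₀, ∀ t ∈ tangent a, ‖t‖ ≤ ρ → ∃ z ∈ W, (∀ j, f j z = f j x) ∧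
      (tangent a).starProjection (z - x) = t ∧ ‖(z - x) - t‖ ≤ δ * ‖z - x‖ := by
  obtain ⟨U, hU, hUle⟩ := exists_nhds_norm_sub_starProjection_le hf hδ
  obtain ⟨ρ, hρ, hev⟩ := eventually_exists_starProjection_eq hf ha (inter_mem hU hW)
  refine ⟨ρ, hρ, ?_⟩
  filter_upwards [hev, hU] with x hx hxU t ht htρ
  obtain ⟨z, hz, hfz, hPz⟩ := hx t ht htρ
  refine ⟨z, hz.2, hfz, hPz, ?_⟩
  rw [← hPz]
  exact hUle z hz.1 x hxU hfz

variable [MeasurableSpace E] [BorelSpace E]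

theorem exists_nhds_measure_level_le (hf : ∀ j, HasStrictFDerivAt (f j) (innerSL ℝ (a j)) x₀)
    {κ : ℝ≥0} (hκ : κ ≠ 0) (hκ1 : κ < 1) (n : ℕ) :
    ∃ U ∈ 𝓝 x₀, ∀ A ⊆ U, (∀ y ∈ A, ∀ z ∈ A, ∀ j, f j y = f j z) →
      (Measure.euclideanHausdorffMeasure n : Measure E) A ≤ ((κ⁻¹ : ℝ≥0) : ℝ≥0∞) ^ n *
        (Measure.euclideanHausdorffMeasure n : Measure (tangent a))
          ((tangent a).orthogonalProjectionOnto '' A) := by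
  obtain ⟨U, hU, hUle⟩ := exists_nhds_norm_sub_starProjection_le hf
    (show (0 : ℝ) < 1 - κ by simpa using hκ1)
  refine ⟨U, hU, fun A hA hAf => euclideanHausdorffMeasure_le_of_projection _ hκ ?_ n⟩
  intro y hy z hz
  have := mul_norm_le_of_norm_sub_le (hUle y (hA hy) z (hA hz) (hAf y hy z hz))
  simpa using this

/-- The projection takes a ball of radius `r` into a ball of the same radius in the `n`-dimensional
tangent space. -/
theorem exists_nhds_measure_level_inter_closedBall_le
    (hf : ∀ j, HasStrictFDerivAt (f j) (innerSL ℝ (a j)) x₀) (ha : LinearIndependent ℝ a)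
    {κ : ℝ≥0} (hκ : κ ≠ 0) (hκ1 : κ < 1) {n : ℕ} (hn : Module.finrank ℝ E - Fintype.card ι = n) :
    ∃ U ∈ 𝓝 x₀, ∀ A ⊆ U, (∀ y ∈ A, ∀ z ∈ A, ∀ j, f j y = f j z) → ∀ x r, 0 ≤ r →
      A ⊆ Metric.closedBall x r →
      (Measure.euclideanHausdorffMeasure n : Measure E) A ≤ ((κ⁻¹ : ℝ≥0) : ℝ≥0∞) ^ n *
        ENNReal.ofReal (r ^ n * unitBallVol n) := by
  obtain ⟨U, hU, hUle⟩ := exists_nhds_measure_level_le hf hκ hκ1 n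
  refine ⟨U, hU, fun A hA hAf x r hr hAr => (hUle A hA hAf).trans ?_⟩
  gcongr
  rw [← euclideanHausdorffMeasure_closedBall n ((finrank_tangent ha).trans hn)
    ((tangent a).orthogonalProjectionOnto x) hr]
  refine measure_mono ?_
  rintro _ ⟨y, hy, rfl⟩
  rw [Metric.mem_closedBall]
  exact ((tangent a).lipschitzWith_orthogonalProjectionOnto.dist_le_mul y x).trans
    (by simpa using hAr hy)

/-- The set is a Lipschitz image of part of the tangent space, whose dimension is less than `n`. -/
theorem exists_nhds_measure_level_eq_zero (hf : ∀ j, HasStrictFDerivAt (f j) (innerSL ℝ (a j)) x₀)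
    (ha : LinearIndependent ℝ a) {n : ℕ} (hn : Module.finrank ℝ E - Fintype.card ι < n) :
    ∃ U ∈ 𝓝 x₀, ∀ A ⊆ U, (∀ y ∈ A, ∀ z ∈ A, ∀ j, f j y = f j z) →
      (Measure.euclideanHausdorffMeasure n : Measure E) A = 0 := by
  obtain ⟨U, hU, hUle⟩ := exists_nhds_measure_level_le (κ := 1 / 2) hf (by norm_num)
    (by rw [← NNReal.coe_lt_coe]; norm_num) n
  refine ⟨U, hU, fun A hA hAf => ?_⟩
  have h0 : (Measure.euclideanHausdorffMeasure n : Measure (tangent a)) = 0 := by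
    have h1 : (μH[n] : Measure (tangent a)) = 0 := by
      refine Real.hausdorffMeasure_of_finrank_lt ?_
      rw [finrank_tangent ha]
      exact_mod_cast hn
    rw [Measure.euclideanHausdorffMeasure_def]
    exact (congrArg _ h1).trans (smul_zero _)
  have := hUle A hA hAf
  rw [h0] at this
  simpa using this

/-- The volume of a set is bounded below by that of a ball onto which it projects. -/
theorem le_measure_of_closedBall_subset_projection (ha : LinearIndependent ℝ a) {n : ℕ}
    (hn : Module.finrank ℝ E - Fintype.card ι = n) {A : Set E} {x : E} {t₀ : E}
    (ht₀ : t₀ ∈ tangent a) {r : ℝ} (hr : 0 ≤ r)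
    (hA : ∀ t ∈ tangent a, ‖t - t₀‖ ≤ r → ∃ z ∈ A, (tangent a).starProjection (z - x) = t) :
    ENNReal.ofReal (r ^ n * unitBallVol n) ≤
      (Measure.euclideanHausdorffMeasure n : Measure E) A := by
  refine le_trans ?_ (euclideanHausdorffMeasure_projection_le (tangent a) A n)
  rw [← euclideanHausdorffMeasure_closedBall n ((finrank_tangent ha).trans hn)
    ((tangent a).orthogonalProjectionOnto x + ⟨t₀, ht₀⟩) hr]
  refine measure_mono fun s hs => ?_
  have hs' : ‖((s - (tangent a).orthogonalProjectionOnto x : tangent a) : E) - t₀‖ ≤ r := by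
    rw [Metric.mem_closedBall, dist_eq_norm, ← sub_sub] at hs
    exact hs
  obtain ⟨z, hz, hPz⟩ := hA _ (SetLike.coe_mem _) hs'
  refine ⟨z, hz, ?_⟩
  have h1 : (tangent a).orthogonalProjectionOnto (z - x) =
      s - (tangent a).orthogonalProjectionOnto x := Subtype.ext hPz
  rw [map_sub] at h1
  exact sub_left_injective h1

end LevelSet

/-! ### Finite volume, null boundary and volume density of the feasible set. -/

section Feasible

variable {d m l : ℕ} {h : Fin m → EuclideanSpace ℝ (Fin d) → ℝ}
  {g : Fin l → EuclideanSpace ℝ (Fin d) → ℝ}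

theorem isClosed_feasibleSet (hh : ∀ j, IsSmoothConstraint (h j))
    (hg : ∀ i, IsSmoothConstraint (g i)) : IsClosed (feasibleSet h g) := by
  have : feasibleSet h g = (⋂ j, {x | h j x = 0}) ∩ ⋂ i, {x | g i x ≤ 0} := by
    ext x; simp [feasibleSet]
  rw [this]
  exact (isClosed_iInter fun j => isClosed_eq (hh j).1.continuous continuous_const).inter
    (isClosed_iInter fun i => isClosed_le (hg i).1.continuous continuous_const)

theorem LICQ.equality (hl : LICQ h g) {x : EuclideanSpace ℝ (Fin d)} (hx : x ∈ feasibleSet h g) :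
    LinearIndependent ℝ (fun j => gradient (h j) x) :=
  (hl x hx).comp (fun j => Sum.inl j) Sum.inl_injective

theorem measure_feasibleSet_lt_top (hh : ∀ j, IsSmoothConstraint (h j))
    (hg : ∀ i, IsSmoothConstraint (g i)) (hl : LICQ h g)
    (hb : Bornology.IsBounded (feasibleSet h g)) :
    (Measure.euclideanHausdorffMeasure (d - m) : Measure (EuclideanSpace ℝ (Fin d)))
      (feasibleSet h g) < ∞ := by
  refine (Metric.isCompact_of_isClosed_isBounded (isClosed_feasibleSet hh hg)
    hb).measure_lt_top_of_nhdsWithin fun x hx => ?_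
  obtain ⟨U, hU, hUle⟩ := exists_nhds_measure_level_inter_closedBall_le (κ := 1 / 2)
    (fun j => (hh j).hasStrictFDerivAt x) (hl.equality hx) (by norm_num)
    (by rw [← NNReal.coe_lt_coe]; norm_num) (n := d - m) (by simp)
  refine ⟨feasibleSet h g ∩ (U ∩ Metric.closedBall x 1), inter_mem self_mem_nhdsWithin
    (mem_nhdsWithin_of_mem_nhds (inter_mem hU (Metric.closedBall_mem_nhds x one_pos))), ?_⟩
  refine (hUle _ (fun y hy => hy.2.1) (fun y hy z hz j => ?_) x 1 zero_le_one
    fun y hy => hy.2.2).trans_lt ?_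
  · rw [hy.1.1 j, hz.1.1 j]
  · exact ENNReal.mul_lt_top (ENNReal.pow_lt_top ENNReal.coe_lt_top) ENNReal.ofReal_lt_top

/-- An active inequality acts as one more independent equality and lowers the dimension by one. -/
theorem measure_active_eq_zero (hmd : m < d) (hh : ∀ j, IsSmoothConstraint (h j))
    (hg : ∀ i, IsSmoothConstraint (g i)) (hl : LICQ h g) :
    (Measure.euclideanHausdorffMeasure (d - m) : Measure (EuclideanSpace ℝ (Fin d)))
      {x ∈ feasibleSet h g | ∃ i, g i x = 0} = 0 := by
  have hset : {x ∈ feasibleSet h g | ∃ i, g i x = 0} =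
      ⋃ i, {x ∈ feasibleSet h g | g i x = 0} := by
    ext x; simp
  rw [hset, measure_iUnion_null_iff]
  intro i
  refine measure_null_of_locally_null _ fun x hx => ?_
  let f : Option (Fin m) → EuclideanSpace ℝ (Fin d) → ℝ := fun o => o.elim (g i) h
  have hf : ∀ o, HasStrictFDerivAt (f o) (innerSL ℝ (gradient (f o) x)) x := by
    rintro (_ | j)
    · exact (hg i).hasStrictFDerivAt x
    · exact (hh j).hasStrictFDerivAt x
  have ha : LinearIndependent ℝ (fun o => gradient (f o) x) := by
    have := (hl x hx.1).comp (fun o : Option (Fin m) => o.elim (Sum.inr ⟨i, hx.2⟩) Sum.inl) (by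
      rintro (_ | j) (_ | j') hj
      · rfl
      · cases hj
      · cases hj
      · exact congrArg some (Sum.inl_injective hj))
    convert this using 2 with o
    rcases o with _ | j <;> rfl
  -- With truncated subtraction, `d - (m + 1) < d - m` needs `m < d`.
  obtain ⟨U, hU, hU0⟩ := exists_nhds_measure_level_eq_zero hf ha (n := d - m) (by
    simp only [finrank_euclideanSpace, Fintype.card_fin, Fintype.card_option]; omega)
  refine ⟨{x ∈ feasibleSet h g | g i x = 0} ∩ U, inter_mem self_mem_nhdsWithin
    (mem_nhdsWithin_of_mem_nhds hU), hU0 _ Set.inter_subset_right ?_⟩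
  rintro y ⟨hy, -⟩ z ⟨hz, -⟩ (_ | j)
  · exact hy.2.trans hz.2.symm
  · exact (hy.1.1 j).trans (hz.1.1 j).symm

/-- The inactive inequalities persist near `x`. A chart point over a tangent vector of length at
most `κ * r` lies within `r` of `x`, so the set in the ball projects onto a tangent ball of radius
`κ * r`. -/
theorem le_measure_feasibleSet_inter_closedBall (hh : ∀ j, IsSmoothConstraint (h j))
    (hg : ∀ i, IsSmoothConstraint (g i)) (hl : LICQ h g) {x : EuclideanSpace ℝ (Fin d)}
    (hx : x ∈ feasibleSet h g) (hact : ∀ i, g i x ≠ 0) {κ : ℝ} (hκ : 0 < κ) (hκ1 : κ < 1) :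
    ∀ᶠ r in 𝓝[>] (0 : ℝ), ENNReal.ofReal ((κ * r) ^ (d - m) * unitBallVol (d - m)) ≤
      (Measure.euclideanHausdorffMeasure (d - m) : Measure (EuclideanSpace ℝ (Fin d)))
        (feasibleSet h g ∩ Metric.closedBall x r) := by
  have hW : ∀ᶠ z in 𝓝 x, ∀ i, g i z < 0 := by
    rw [eventually_all]
    exact fun i => (hg i).1.continuous.continuousAt.eventually_lt continuousAt_const
      (lt_of_le_of_ne (hx.2 i) (hact i))
  obtain ⟨ρ, hρ, hev⟩ := exists_chart (fun j => (hh j).hasStrictFDerivAt x) (hl.equality hx)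
    (sub_pos.2 hκ1) hW
  have hx' := hev.self_of_nhds
  filter_upwards [self_mem_nhdsWithin, mem_nhdsWithin_of_mem_nhds (Iio_mem_nhds hρ)] with r hr hrρ
  have hr : 0 < r := hr
  have hrρ : r < ρ := hrρ
  refine le_measure_of_closedBall_subset_projection (hl.equality hx) (by simp) (x := x)
    (t₀ := 0) (zero_mem _) (by positivity) fun t ht htr => ?_
  rw [sub_zero] at htr
  obtain ⟨z, hz, hhz, hPz, hle⟩ := hx' t ht (htr.trans (by nlinarith))
  refine ⟨z, ⟨⟨fun j => (hhz j).trans (hx.1 j), fun i => (hz i).le⟩, ?_⟩, hPz⟩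
  have := mul_norm_le_of_norm_sub_le hle
  rw [sub_sub_cancel] at this
  rw [Metric.mem_closedBall, dist_eq_norm]
  exact le_of_mul_le_mul_left (this.trans htr) hκ

theorem measure_feasibleSet_inter_closedBall_le (hh : ∀ j, IsSmoothConstraint (h j))
    (hl : LICQ h g) {x : EuclideanSpace ℝ (Fin d)}
    (hx : x ∈ feasibleSet h g) {κ : ℝ} (hκ : 0 < κ) (hκ1 : κ < 1) :
    ∀ᶠ r in 𝓝[>] (0 : ℝ),
      (Measure.euclideanHausdorffMeasure (d - m) : Measure (EuclideanSpace ℝ (Fin d)))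
        (feasibleSet h g ∩ Metric.closedBall x r) ≤
      ENNReal.ofReal ((κ⁻¹ * r) ^ (d - m) * unitBallVol (d - m)) := by
  obtain ⟨U, hU, hUle⟩ := exists_nhds_measure_level_inter_closedBall_le (κ := ⟨κ, hκ.le⟩)
    (fun j => (hh j).hasStrictFDerivAt x) (hl.equality hx)
    (fun h0 => hκ.ne' (congrArg NNReal.toReal h0)) hκ1 (n := d - m) (by simp)
  obtain ⟨ε, hε, hball⟩ := Metric.mem_nhds_iff.1 hU
  filter_upwards [self_mem_nhdsWithin, mem_nhdsWithin_of_mem_nhds (Iio_mem_nhds hε)] with r hr hrε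
  refine (hUle _ (fun y hy => hball (lt_of_le_of_lt (Metric.mem_closedBall.1 hy.2) hrε))
    (fun y hy z hz j => ?_) x r (le_of_lt hr) fun y hy => hy.2).trans ?_
  · rw [hy.1.1 j, hz.1.1 j]
  · have h1 : (((⟨κ, hκ.le⟩ : ℝ≥0)⁻¹ : ℝ≥0) : ℝ≥0∞) = ENNReal.ofReal κ⁻¹ := by
      rw [← ENNReal.ofReal_coe_nnreal]; rfl
    rw [h1, ← ENNReal.ofReal_pow (by positivity), ← ENNReal.ofReal_mul (by positivity), mul_pow,
      mul_assoc]

/-- The two ball bounds squeeze the ratio between `κ ^ p * V` and `κ⁻¹ ^ p * V` for each `κ < 1`;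
then `κ → 1`. -/
theorem tendsto_volume_density (hh : ∀ j, IsSmoothConstraint (h j))
    (hg : ∀ i, IsSmoothConstraint (g i)) (hl : LICQ h g) {x : EuclideanSpace ℝ (Fin d)}
    (hx : x ∈ feasibleSet h g) (hact : ∀ i, g i x ≠ 0) :
    Tendsto (fun r => vol (d - m) (feasibleSet h g ∩ Metric.closedBall x r) / r ^ (d - m))
      (𝓝[>] 0) (𝓝 (unitBallVol (d - m))) := by
  set p := d - m
  set V := unitBallVol p
  have hV : 0 < V := unitBallVol_pos p
  have key : ∀ κ : ℝ, 0 < κ → κ < 1 → ∀ᶠ r in 𝓝[>] (0 : ℝ),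
      κ ^ p * V ≤ vol p (feasibleSet h g ∩ Metric.closedBall x r) / r ^ p ∧
      vol p (feasibleSet h g ∩ Metric.closedBall x r) / r ^ p ≤ κ⁻¹ ^ p * V := by
    intro κ hκ hκ1
    filter_upwards [le_measure_feasibleSet_inter_closedBall hh hg hl hx hact hκ hκ1,
      measure_feasibleSet_inter_closedBall_le hh hl hx hκ hκ1, self_mem_nhdsWithin] with r h1 h2 hr
    have hr : 0 < r := hr
    rw [le_div_iff₀ (by positivity), div_le_iff₀ (by positivity)]
    constructor
    · have := ENNReal.toReal_mono (h2.trans_lt ENNReal.ofReal_lt_top).ne h1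
      rw [ENNReal.toReal_ofReal (by positivity)] at this
      rw [mul_right_comm, ← mul_pow]
      exact this
    · have := ENNReal.toReal_mono ENNReal.ofReal_ne_top h2
      rw [ENNReal.toReal_ofReal (by positivity)] at this
      rw [mul_right_comm, ← mul_pow]
      exact this
  have hIoo : ∀ᶠ κ in 𝓝[<] (1 : ℝ), 0 < κ ∧ κ < 1 := by
    filter_upwards [Ioo_mem_nhdsLT (zero_lt_one' ℝ)] with κ hκ using hκ
  have c1 : Tendsto (fun κ : ℝ => κ ^ p * V) (𝓝[<] 1) (𝓝 V) := by
    have : ContinuousAt (fun κ : ℝ => κ ^ p * V) 1 := by fun_prop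
    simpa [ContinuousAt] using this.tendsto.mono_left (nhdsWithin_le_nhds (s := Set.Iio 1))
  have c2 : Tendsto (fun κ : ℝ => κ⁻¹ ^ p * V) (𝓝[<] 1) (𝓝 V) := by
    have : ContinuousAt (fun κ : ℝ => κ⁻¹ ^ p * V) 1 :=
      ((continuousAt_inv₀ one_ne_zero).pow p).mul_const V
    simpa [ContinuousAt] using this.tendsto.mono_left (nhdsWithin_le_nhds (s := Set.Iio 1))
  rw [tendsto_order]
  constructor
  · intro b hb
    obtain ⟨κ, hκ, hκ0, hκ1⟩ := ((c1.eventually (lt_mem_nhds hb)).and hIoo).exists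
    filter_upwards [key κ hκ0 hκ1] with r hr using hκ.trans_le hr.1
  · intro b hb
    obtain ⟨κ, hκ, hκ0, hκ1⟩ := ((c2.eventually (gt_mem_nhds hb)).and hIoo).exists
    filter_upwards [key κ hκ0 hκ1] with r hr using hr.2.trans_lt hκ

end Feasible

/-! ### A uniform lower volume bound up to the boundary. -/

section Feasible

variable {d m l : ℕ} {h : Fin m → EuclideanSpace ℝ (Fin d) → ℝ}
  {g : Fin l → EuclideanSpace ℝ (Fin d) → ℝ}

/-- A tangent direction that points strictly inwards for all active inequality constraints. -/
theorem LICQ.exists_inward (hl : LICQ h g) {x : EuclideanSpace ℝ (Fin d)}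
    (hx : x ∈ feasibleSet h g) : ∃ v ∈ tangent (fun j => gradient (h j) x),
      ∀ i, g i x = 0 → inner ℝ (gradient (g i) x) v = -1 := by
  obtain ⟨v, hv⟩ := exists_inner_eq (hl x hx) (Sum.elim (fun _ => 0) fun _ => -1)
  refine ⟨v, ?_, fun i hi => hv (Sum.inr ⟨i, hi⟩)⟩
  refine (Submodule.mem_orthogonal _ _).2 fun u hu => ?_
  induction hu using Submodule.span_induction with
  | mem x hx => obtain ⟨j, rfl⟩ := hx; exact hv (Sum.inl j)
  | zero => simp
  | add x y _ _ hx hy => simp [inner_add_left, hx, hy]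
  | smul r x _ hx => simp [inner_smul_left, hx]

/-- To first order the increment `e` is `s * ⟨b, v⟩ = -s`. Replacing `s • v` by `t` costs at most `s
/ 4`; replacing `t` by `w`, together with the linearization error, costs at most `2 * B * δ * (G +
1) * s ≤ s / 4`. -/
theorem inequality_decreases {E : Type*} [NormedAddCommGroup E] [InnerProductSpace ℝ E]
    {b v t w : E} {G B δ κ s e : ℝ} (hG : ‖b‖ ≤ G) (hδ : 0 ≤ δ)
    (hδ1 : δ ≤ 1 / 2) (hκ : κ * G ≤ 1 / 4) (hδ2 : 8 * (B * (δ * (G + 1))) ≤ 1) (hs : 0 ≤ s)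
    (hbv : inner ℝ b v = -1)
    (ht : ‖t - s • v‖ ≤ κ * s) (hw : ‖w - t‖ ≤ δ * ‖w‖) (htB : ‖t‖ ≤ B * s)
    (he : |e - inner ℝ b w| ≤ δ * ‖w‖) : e ≤ 0 := by
  have hG0 : 0 ≤ G := (norm_nonneg b).trans hG
  have hw2 : ‖w‖ ≤ 2 * B * s := by
    have := mul_norm_le_of_norm_sub_le hw
    nlinarith [norm_nonneg w]
  have e1 : inner ℝ b w = inner ℝ b (w - t) + inner ℝ b (t - s • v) + s * inner ℝ b v := by
    rw [← inner_smul_right, ← inner_add_right, ← inner_add_right]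
    congr 1
    abel
  have e2 : inner ℝ b (w - t) ≤ G * (δ * (2 * B * s)) :=
    (real_inner_le_norm _ _).trans (mul_le_mul hG (hw.trans (by gcongr)) (norm_nonneg _) hG0)
  have e3 : inner ℝ b (t - s • v) ≤ G * (κ * s) :=
    (real_inner_le_norm _ _).trans (mul_le_mul hG ht (norm_nonneg _) hG0)
  have e4 : e ≤ inner ℝ b w + δ * (2 * B * s) := by
    have h1 := (abs_le.1 he).2
    have h2 : δ * ‖w‖ ≤ δ * (2 * B * s) := by gcongr
    linarith
  rw [hbv] at e1
  nlinarith [mul_le_mul_of_nonneg_right hκ hs, mul_le_mul_of_nonneg_right hδ2 hs]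

/-- The chart at `x` is used only over a tangent ball centred at the inward vector `s • v`, with
radius and shift proportional to `r`. There the constraints active at `x₀` do not increase and the
others stay negative. Direction, tangent space and constants are those of `x₀`, so the bound is
uniform in nearby `x`. -/
theorem exists_lower_volume_bound_near (hh : ∀ j, IsSmoothConstraint (h j))
    (hg : ∀ i, IsSmoothConstraint (g i)) (hl : LICQ h g) {x₀ : EuclideanSpace ℝ (Fin d)}
    (hx₀ : x₀ ∈ feasibleSet h g) :
    ∃ c > 0, ∃ r₀ > 0, ∀ᶠ x in 𝓝 x₀, x ∈ feasibleSet h g → ∀ r, 0 < r → r ≤ r₀ →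
      ENNReal.ofReal (c * r ^ (d - m)) ≤
      (Measure.euclideanHausdorffMeasure (d - m) : Measure (EuclideanSpace ℝ (Fin d)))
        (feasibleSet h g ∩ Metric.closedBall x r) := by
  obtain ⟨v, hvT, hv⟩ := hl.exists_inward hx₀
  -- The summand `1` keeps `G` positive for the divisions below.
  set G : ℝ := 1 + ∑ i, ‖gradient (g i) x₀‖ with hGdef
  have hG : ∀ i, ‖gradient (g i) x₀‖ ≤ G := fun i => by
    have := Finset.single_le_sum (f := fun i => ‖gradient (g i) x₀‖) (fun i _ => norm_nonneg _)
      (Finset.mem_univ i)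
    linarith
  have hG0 : 0 < G := by positivity
  set B : ℝ := ‖v‖ + 1 with hBdef
  have hB0 : 0 < B := by positivity
  set κ : ℝ := min 1 (1 / (4 * G)) with hκdef
  have hκ0 : 0 < κ := by positivity
  have hκG : κ * G ≤ 1 / 4 := by
    calc κ * G ≤ 1 / (4 * G) * G := by gcongr; exact min_le_right _ _
      _ = 1 / 4 := by field_simp
  set δ : ℝ := min (1 / 2) (1 / (8 * (B * (G + 1)))) with hδdef
  have hδ0 : 0 < δ := by positivity
  have hδ2 : 8 * (B * (δ * (G + 1))) ≤ 1 := by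
    calc 8 * (B * (δ * (G + 1))) ≤ 8 * (B * (1 / (8 * (B * (G + 1))) * (G + 1))) := by
          gcongr; exact min_le_right _ _
      _ = 1 := by field_simp
  have hg1 : ∀ᶠ q : EuclideanSpace ℝ (Fin d) × EuclideanSpace ℝ (Fin d) in 𝓝 (x₀, x₀),
      ∀ i, |g i q.1 - g i q.2 - inner ℝ (gradient (g i) x₀) (q.1 - q.2)| ≤ δ * ‖q.1 - q.2‖ := by
    rw [eventually_all]
    exact fun i => ((hg i).hasStrictFDerivAt x₀).isLittleO.def hδ0
  rw [nhds_prod_eq] at hg1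
  obtain ⟨W₁, hW₁, hW₁g⟩ := mem_prod_same_iff.1 hg1
  have hW₂ : ∀ᶠ z in 𝓝 x₀, ∀ i, g i x₀ ≠ 0 → g i z < 0 := by
    rw [eventually_all]
    intro i
    by_cases hi : g i x₀ = 0
    · simp [hi]
    · filter_upwards [(hg i).1.continuous.continuousAt.eventually_lt continuousAt_const
        (lt_of_le_of_ne (hx₀.2 i) hi)] with z hz _ using hz
  obtain ⟨ρ, hρ, hev⟩ := exists_chart (fun j => (hh j).hasStrictFDerivAt x₀) (hl.equality hx₀)
    hδ0 (inter_mem hW₁ hW₂)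
  have hV : 0 < unitBallVol (d - m) := unitBallVol_pos _
  -- With `s = r / (2 * B)` the tangent vectors have norm at most `B * s = r / 2`. This is within
  -- the chart radius `ρ` when `r ≤ 2 * ρ`, and since `δ ≤ 1 / 2` the chart points stay within `r`
  -- of `x`.
  refine ⟨(κ / (2 * B)) ^ (d - m) * unitBallVol (d - m), by positivity, 2 * ρ, by positivity, ?_⟩
  filter_upwards [hev, hW₁] with x hx hxW hxS r hr hrρ
  set s : ℝ := r / (2 * B) with hsdef
  have hs : 0 < s := by positivity
  have hsr : 2 * B * s = r := by rw [hsdef]; field_simp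
  have hsv : s • v ∈ tangent (fun j => gradient (h j) x₀) := Submodule.smul_mem _ _ hvT
  have e1 : (κ / (2 * B)) ^ (d - m) * unitBallVol (d - m) * r ^ (d - m) =
      (κ * s) ^ (d - m) * unitBallVol (d - m) := by
    rw [mul_right_comm, ← mul_pow, hsdef]
    congr 2
    ring
  rw [e1]
  refine le_measure_of_closedBall_subset_projection (hl.equality hx₀) (by simp) (x := x)
    hsv (by positivity) fun t ht htr => ?_
  have htB : ‖t‖ ≤ B * s := by
    calc ‖t‖ = ‖(t - s • v) + s • v‖ := by rw [sub_add_cancel]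
      _ ≤ κ * s + s * ‖v‖ := (norm_add_le _ _).trans (add_le_add htr
          (by rw [norm_smul, Real.norm_of_nonneg hs.le]))
      _ ≤ 1 * s + s * ‖v‖ := by gcongr; exact min_le_left _ _
      _ = B * s := by rw [hBdef]; ring
  obtain ⟨z, hz, hhz, hPz, hle⟩ := hx t ht (htB.trans (by linarith))
  refine ⟨z, ⟨⟨fun j => (hhz j).trans (hxS.1 j), fun i => ?_⟩, ?_⟩, hPz⟩
  · by_cases hi : g i x₀ = 0
    · have := inequality_decreases (hG i) hδ0.le (min_le_left _ _) hκG hδ2 hs.le (hv i hi) htr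
        hle htB (hW₁g (Set.mk_mem_prod hz.1 hxW) i)
      linarith [hxS.2 i]
    · exact (hz.2 i hi).le
  · rw [Metric.mem_closedBall, dist_eq_norm]
    have h1 := mul_norm_le_of_norm_sub_le hle
    have h2 : δ ≤ 1 / 2 := min_le_left _ _
    nlinarith [norm_nonneg (z - x)]

theorem exists_lower_volume_bound (hh : ∀ j, IsSmoothConstraint (h j))
    (hg : ∀ i, IsSmoothConstraint (g i)) (hl : LICQ h g)
    (hb : Bornology.IsBounded (feasibleSet h g)) :
    ∃ c > 0, ∃ r₀ > 0, ∀ x ∈ feasibleSet h g, ∀ r, 0 < r → r ≤ r₀ →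
      ENNReal.ofReal (c * r ^ (d - m)) ≤
      (Measure.euclideanHausdorffMeasure (d - m) : Measure (EuclideanSpace ℝ (Fin d)))
        (feasibleSet h g ∩ Metric.closedBall x r) := by
  have hK := Metric.isCompact_of_isClosed_isBounded (isClosed_feasibleSet hh hg) hb
  refine hK.induction_on (p := fun s => ∃ c > 0, ∃ r₀ > 0, ∀ x ∈ s, ∀ r, 0 < r → r ≤ r₀ →
      ENNReal.ofReal (c * r ^ (d - m)) ≤
      (Measure.euclideanHausdorffMeasure (d - m) : Measure (EuclideanSpace ℝ (Fin d)))
        (feasibleSet h g ∩ Metric.closedBall x r)) ?_ ?_ ?_ ?_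
  · exact ⟨1, one_pos, 1, one_pos, by simp⟩
  · rintro s t hst ⟨c, hc, r₀, hr₀, H⟩
    exact ⟨c, hc, r₀, hr₀, fun x hx => H x (hst hx)⟩
  · rintro s t ⟨c, hc, r₀, hr₀, H⟩ ⟨c', hc', r₀', hr₀', H'⟩
    refine ⟨min c c', lt_min hc hc', min r₀ r₀', lt_min hr₀ hr₀', ?_⟩
    rintro x (hx | hx) r hr hrr
    · refine le_trans (ENNReal.ofReal_le_ofReal ?_) (H x hx r hr (hrr.trans (min_le_left _ _)))
      gcongr
      exact min_le_left _ _
    · refine le_trans (ENNReal.ofReal_le_ofReal ?_) (H' x hx r hr (hrr.trans (min_le_right _ _)))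
      gcongr
      exact min_le_right _ _
  · intro x hx
    obtain ⟨c, hc, r₀, hr₀, H⟩ := exists_lower_volume_bound_near hh hg hl hx
    exact ⟨_, inter_mem self_mem_nhdsWithin (mem_nhdsWithin_of_mem_nhds H), c, hc, r₀, hr₀,
      fun y hy => hy.2 hy.1⟩

end Feasible

/-! ### Separation of the connected components. -/

section Components

variable {X : Type*} {S : Set X} {C : ℕ} {comp : Fin C → Set X}

theorem isClosed_connectedComponentIn [TopologicalSpace X] (hS : IsClosed S) (x : X) :
    IsClosed (connectedComponentIn S x) := by
  by_cases hx : x ∈ S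
  · rw [connectedComponentIn_eq_image hx]
    exact hS.isClosedEmbedding_subtypeVal.isClosedMap _ isClosed_connectedComponent
  · rw [connectedComponentIn_eq_empty hx]
    exact isClosed_empty

namespace IsComponentDecomposition

theorem isClosed [TopologicalSpace X] (hc : IsComponentDecomposition S comp) (hS : IsClosed S)
    (c : Fin C) : IsClosed (comp c) := by
  obtain ⟨x, -, hx⟩ := hc.eq_component c
  exact hx ▸ isClosed_connectedComponentIn hS x

theorem subset [TopologicalSpace X] (hc : IsComponentDecomposition S comp) (c : Fin C) :
    comp c ⊆ S :=
  hc.iUnion_eq ▸ Set.subset_iUnion comp c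

theorem nonempty [TopologicalSpace X] (hc : IsComponentDecomposition S comp) (c : Fin C) :
    (comp c).Nonempty := by
  obtain ⟨x, hxS, hx⟩ := hc.eq_component c
  exact ⟨x, hx ▸ mem_connectedComponentIn hxS⟩

/-- Disjoint compact sets have positive distance, and there are finitely many pairs. -/
theorem exists_separation [MetricSpace X] (hc : IsComponentDecomposition S comp)
    (hS : IsCompact S) :
    ∃ δ > 0, ∀ a b, a ≠ b → ∀ x ∈ comp a, ∀ y ∈ comp b, δ < dist x y := by
  have hK : ∀ c, IsCompact (comp c) := fun c =>
    hS.of_isClosed_subset (hc.isClosed hS.isClosed c) (hc.subset c)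
  have key : ∀ q : Fin C × Fin C, ∀ᶠ δ in 𝓝[>] (0 : ℝ), q.1 ≠ q.2 →
      ∀ x ∈ comp q.1, ∀ y ∈ comp q.2, δ < dist x y := by
    rintro ⟨a, b⟩
    by_cases hab : a = b
    · simp [hab]
    · obtain ⟨r, hr, H⟩ := Metric.exists_pos_forall_lt_edist (hK a) (hK b).isClosed
        (hc.disjoint hab)
      filter_upwards [mem_nhdsWithin_of_mem_nhds (Iio_mem_nhds (NNReal.coe_pos.2 hr))]
        with δ hδ _ x hx y hy
      refine lt_trans hδ ?_
      have h1 := H x hx y hy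
      rw [edist_nndist, ENNReal.coe_lt_coe] at h1
      exact_mod_cast h1
  obtain ⟨δ, hδ, hδ0⟩ := ((eventually_all.2 key).and self_mem_nhdsWithin).exists
  exact ⟨δ, hδ0, fun a b => hδ (a, b)⟩

end IsComponentDecomposition

end Components

/-- Probability measures on separated closed sets that look near almost every point like
`σ⁻¹` times Lebesgue measure on `p`-dimensional space with unit ball volume `V`, and give small
balls a uniformly large mass. -/
structure IsUniformFamily {X : Type*} [MetricSpace X] [MeasurableSpace X] {C : ℕ} (p : ℕ) (V : ℝ)
    (comp : Fin C → Set X) (u : Fin C → Measure X) (σ : Fin C → ℝ) : Prop where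
  prob : ∀ c, IsProbabilityMeasure (u c)
  pos : ∀ c, 0 < σ c
  closed : ∀ c, IsClosed (comp c)
  ae_mem : ∀ c, ∀ᵐ x ∂u c, x ∈ comp c
  separated : ∃ δ > 0, ∀ a b, a ≠ b → ∀ x ∈ comp a, ∀ y ∈ comp b, δ < dist x y
  lower : ∃ κ > 0, ∃ D > 0, ∀ c, ∀ x ∈ comp c, (∀ y ∈ comp c, dist x y ≤ D) ∧
    ∀ r, 0 < r → r ≤ D → κ * r ^ p ≤ (u c).real (Metric.closedBall x r)
  density : ∀ c, ∀ᵐ x ∂u c,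
    Tendsto (fun r => (u c).real (Metric.closedBall x r) / r ^ p) (𝓝[>] 0) (𝓝 (V / σ c))

/-! ### The uniform laws on the components. -/

section Uniform

variable {d m l C : ℕ} {h : Fin m → EuclideanSpace ℝ (Fin d) → ℝ}
  {g : Fin l → EuclideanSpace ℝ (Fin d) → ℝ} {comp : Fin C → Set (EuclideanSpace ℝ (Fin d))}

theorem uniformOn_real {d : ℕ} (p : ℕ) {A : Set (EuclideanSpace ℝ (Fin d))} (hA : MeasurableSet A)
    (B : Set (EuclideanSpace ℝ (Fin d))) :
    (uniformOn p A).real B = vol p (A ∩ B) / vol p A := by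
  rw [uniformOn, Measure.real, ProbabilityTheory.cond_apply hA, ENNReal.toReal_mul,
    ENNReal.toReal_inv, vol, vol, Measure.real, Measure.real, inv_mul_eq_div]

/-- This collects all the geometry; the probabilistic estimates below rely on `IsUniformFamily`
alone. -/
theorem isUniformFamily_uniformOn (hmd : m < d) (hh : ∀ j, IsSmoothConstraint (h j))
    (hg : ∀ i, IsSmoothConstraint (g i)) (hl : LICQ h g)
    (hb : Bornology.IsBounded (feasibleSet h g))
    (hcomp : IsComponentDecomposition (feasibleSet h g) comp) :
    IsUniformFamily (d - m) (unitBallVol (d - m)) comp (fun c => uniformOn (d - m) (comp c))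
      (fun c => vol (d - m) (comp c)) := by
  set μ := (Measure.euclideanHausdorffMeasure (d - m) : Measure (EuclideanSpace ℝ (Fin d)))
  have hSc := isClosed_feasibleSet hh hg
  have hSK := Metric.isCompact_of_isClosed_isBounded hSc hb
  have hclosed := hcomp.isClosed hSc
  have hmeas : ∀ c, MeasurableSet (comp c) := fun c => (hclosed c).measurableSet
  obtain ⟨δ, hδ, hsep⟩ := hcomp.exists_separation hSK
  obtain ⟨c₀, hc₀, r₀, hr₀, hlow⟩ := exists_lower_volume_bound hh hg hl hb
  have hfin : ∀ A ⊆ feasibleSet h g, μ A ≠ ∞ := fun A hA =>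
    ((measure_mono hA).trans_lt (measure_feasibleSet_lt_top hh hg hl hb)).ne
  have hfin' : ∀ c, μ (comp c) ≠ ∞ := fun c => hfin _ (hcomp.subset c)
  -- Below the separation distance a ball meets only the component of its centre, so volume bounds
  -- for the whole set localize.
  have hinter : ∀ c, ∀ x ∈ comp c, ∀ r ≤ δ,
      feasibleSet h g ∩ Metric.closedBall x r = comp c ∩ Metric.closedBall x r := by
    intro c x hx r hr
    refine Set.Subset.antisymm (fun y hy => ⟨?_, hy.2⟩)
      (Set.inter_subset_inter_left _ (hcomp.subset c))
    have hy1 := hy.1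
    rw [← hcomp.iUnion_eq, Set.mem_iUnion] at hy1
    obtain ⟨b, hb⟩ := hy1
    by_contra hyc
    have hbc : b ≠ c := fun hbc => hyc (hbc ▸ hb)
    have h1 := hsep b c hbc y hb x hx
    have h2 := Metric.mem_closedBall.1 hy.2
    linarith
  have hlow' : ∀ c, ∀ x ∈ comp c, ∀ r, 0 < r → r ≤ min δ r₀ →
      c₀ * r ^ (d - m) ≤ vol (d - m) (comp c ∩ Metric.closedBall x r) := by
    intro c x hx r hr hrr
    have h1 := hlow x (hcomp.subset c hx) r hr (hrr.trans (min_le_right _ _))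
    rw [hinter c x hx r (hrr.trans (min_le_left _ _))] at h1
    have h2 := ENNReal.toReal_mono (hfin _ (Set.inter_subset_left.trans (hcomp.subset c))) h1
    rwa [ENNReal.toReal_ofReal (by positivity)] at h2
  have hr₁ : 0 < min δ r₀ := lt_min hδ hr₀
  have hpos : ∀ c, 0 < vol (d - m) (comp c) := by
    intro c
    obtain ⟨x, hx⟩ := hcomp.nonempty c
    refine lt_of_lt_of_le (by positivity) ((hlow' c x hx _ hr₁ le_rfl).trans ?_)
    exact ENNReal.toReal_mono (hfin' c) (measure_mono Set.inter_subset_left)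
  have hpos' : ∀ c, μ (comp c) ≠ 0 := fun c h0 => (hpos c).ne' (by
    rw [vol, Measure.real]; exact (congrArg ENNReal.toReal h0).trans ENNReal.toReal_zero)
  have hprob : ∀ c, IsProbabilityMeasure (uniformOn (d - m) (comp c)) := fun c =>
    cond_isProbabilityMeasure_of_finite (hpos' c) (hfin' c)
  have hmem : ∀ c, ∀ᵐ x ∂uniformOn (d - m) (comp c), x ∈ comp c := fun c => ae_cond_mem (hmeas c)
  refine ⟨hprob, hpos, hclosed, hmem, ⟨δ, hδ, hsep⟩, ?_, ?_⟩
  · set r₁ := min δ r₀ with hr₁def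
    obtain ⟨D, hD, hdiam⟩ : ∃ D > 0, ∀ x ∈ feasibleSet h g, ∀ y ∈ feasibleSet h g, dist x y ≤ D := by
      obtain ⟨D, hD⟩ := Metric.isBounded_iff.1 hb
      exact ⟨max D 1, by positivity, fun x hx y hy => (hD hx hy).trans (le_max_left _ _)⟩
    set S := vol (d - m) (feasibleSet h g)
    have hvS : ∀ c, vol (d - m) (comp c) ≤ S := fun c =>
      ENNReal.toReal_mono (hfin _ subset_rfl) (measure_mono (hcomp.subset c))
    by_cases hC : Nonempty (Fin C)
    swap
    · exact ⟨1, one_pos, 1, one_pos, fun c => (hC ⟨c⟩).elim⟩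
    have hS : 0 < S := (hpos hC.some).trans_le (hvS _)
    -- To reach all radii up to the diameter bound `D`, `r` is shrunk to `s = min 1 (r₁ / D) * r`,
    -- which is at most `r₁`. Dividing by the total volume `S` makes the constant independent of
    -- `c`.
    refine ⟨c₀ / S * (min 1 (r₁ / D)) ^ (d - m), by positivity, D, hD, fun c x hx =>
      ⟨fun y hy => hdiam x (hcomp.subset c hx) y (hcomp.subset c hy), fun r hr hrD => ?_⟩⟩
    rw [uniformOn_real _ (hmeas c)]
    set s := min 1 (r₁ / D) * r with hs
    have hs0 : 0 < s := by positivity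
    have hsr : s ≤ r := mul_le_of_le_one_left hr.le (min_le_left _ _)
    have hsr₁ : s ≤ r₁ := by
      calc s ≤ r₁ / D * D := by rw [hs]; gcongr; exact min_le_right _ _
        _ = r₁ := by field_simp
    have h1 := hlow' c x hx s hs0 hsr₁
    have h2 : vol (d - m) (comp c ∩ Metric.closedBall x s) ≤
        vol (d - m) (comp c ∩ Metric.closedBall x r) :=
      ENNReal.toReal_mono (hfin _ (Set.inter_subset_left.trans (hcomp.subset c)))
        (measure_mono (Set.inter_subset_inter_right _ (Metric.closedBall_subset_closedBall hsr)))
    calc c₀ / S * min 1 (r₁ / D) ^ (d - m) * r ^ (d - m) = c₀ * s ^ (d - m) / S := by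
          rw [hs, mul_pow]; ring
      _ ≤ vol (d - m) (comp c ∩ Metric.closedBall x r) / S := by
          gcongr; exact h1.trans h2
      _ ≤ _ := div_le_div_of_nonneg_left ENNReal.toReal_nonneg (hpos c) (hvS c)
  · intro c
    -- Almost every point has no active inequality, so the density theorem applies there.
    have hnull : ∀ᵐ x ∂uniformOn (d - m) (comp c),
        x ∉ {x ∈ feasibleSet h g | ∃ i, g i x = 0} :=
      cond_absolutelyContinuous.ae_le
        (measure_eq_zero_iff_ae_notMem.1 (measure_active_eq_zero hmd hh hg hl))
    filter_upwards [hmem c, hnull] with x hx hxn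
    have hact : ∀ i, g i x ≠ 0 := fun i hi => hxn ⟨hcomp.subset c hx, i, hi⟩
    have hden := (tendsto_volume_density hh hg hl (hcomp.subset c hx) hact).div_const
      (vol (d - m) (comp c))
    refine hden.congr' ?_
    filter_upwards [mem_nhdsWithin_of_mem_nhds (Iic_mem_nhds hδ)] with r hr
    rw [uniformOn_real _ (hmeas c), hinter c x hx r hr]
    ring

end Uniform

/-! ### Neighbour counts -/

section Count

variable {X : Type*} [PseudoMetricSpace X] {N : ℕ}

/-- The number of points other than `x i` within distance `r` of `x i`. -/
def neighbourCount (x : Fin N → X) (i : Fin N) (r : ℝ) : ℕ :=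
  Nat.card {j : Fin N // j ≠ i ∧ dist (x i) (x j) ≤ r}

theorem neighbourCount_mono (x : Fin N → X) (i : Fin N) : Monotone (neighbourCount x i) :=
  fun _ _ hrs => Nat.card_le_card_of_injective
    (fun j => ⟨j.1, j.2.1, j.2.2.trans hrs⟩) fun _ _ h => Subtype.ext (congrArg (·.1) h)

open Classical in
theorem neighbourCount_eq_sum (x : Fin N → X) (i : Fin N) (r : ℝ) :
    neighbourCount x i r = ∑ j, if j ≠ i ∧ dist (x i) (x j) ≤ r then 1 else 0 := by
  rw [neighbourCount, Nat.card_eq_fintype_card, Fintype.card_subtype, Finset.card_filter]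

theorem neighbourCount_lt (x : Fin N → X) (i : Fin N) (r : ℝ) : neighbourCount x i r < N := by
  have h := Finite.card_subtype_lt (p := fun j => j ≠ i ∧ dist (x i) (x j) ≤ r) (x := i) (by simp)
  rwa [Nat.card_fin] at h

/-- The `+ 1` accounts for `i` itself, which `neighbourCount` leaves out. -/
theorem card_label_le_neighbourCount {C : ℕ} {lab : Fin N → Fin C} {x : Fin N → X} {i : Fin N}
    {r : ℝ} (h : ∀ j, lab j = lab i → dist (x i) (x j) ≤ r) :
    Nat.card {j : Fin N // lab j = lab i} ≤ neighbourCount x i r + 1 := by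
  classical
  have h1 : neighbourCount x i r + 1 = Nat.card {j : Fin N // j = i ∨ dist (x i) (x j) ≤ r} := by
    rw [neighbourCount, Nat.card_eq_fintype_card, Nat.card_eq_fintype_card, Fintype.card_subtype,
      Fintype.card_subtype, ← Finset.card_insert_of_notMem (a := i) (by simp)]
    congr 1
    ext j
    simp only [Finset.mem_insert, Finset.mem_filter, Finset.mem_univ, true_and]
    tauto
  rw [h1]
  exact Nat.card_le_card_of_injective (fun j => ⟨j.1, Or.inr (h j.1 j.2)⟩)
    fun _ _ h => Subtype.ext (congrArg (·.1) h)

theorem knnRadius_nonneg (k : ℕ) (x : Fin N → X) (i : Fin N) : 0 ≤ knnRadius k x i :=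
  Real.sInf_nonneg fun _ hr => hr.1

/-- This turns events about radii into events about counts. The infimum is attained because there
are finitely many distances, so the count does not change just to the right of `r`. -/
theorem knnRadius_le_iff {k : ℕ} (hk : k < N) (x : Fin N → X) (i : Fin N) {r : ℝ} (hr : 0 ≤ r) :
    knnRadius k x i ≤ r ↔ k ≤ neighbourCount x i r := by
  have hbdd : BddBelow {r : ℝ | 0 ≤ r ∧ k ≤ neighbourCount x i r} := ⟨0, fun _ h => h.1⟩
  refine ⟨fun h => ?_, fun h => csInf_le hbdd ⟨hr, h⟩⟩
  have hne : {r : ℝ | 0 ≤ r ∧ k ≤ neighbourCount x i r}.Nonempty := by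
    -- The sum dominates every distance, so all `N - 1 ≥ k` other points are counted.
    refine ⟨∑ j, dist (x i) (x j), Finset.sum_nonneg fun _ _ => dist_nonneg, ?_⟩
    have h1 := card_label_le_neighbourCount (lab := fun _ : Fin N => (0 : Fin 1)) (x := x) (i := i)
      (r := ∑ j, dist (x i) (x j)) fun j _ =>
        Finset.single_le_sum (f := fun j => dist (x i) (x j)) (fun _ _ => dist_nonneg)
          (Finset.mem_univ j)
    simp at h1
    omega
  have hev : ∀ᶠ s in 𝓝[>] r, ∀ j, dist (x i) (x j) ≤ s → dist (x i) (x j) ≤ r := by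
    rw [eventually_all]
    intro j
    by_cases hj : dist (x i) (x j) ≤ r
    · simp [hj]
    · filter_upwards [mem_nhdsWithin_of_mem_nhds (Iio_mem_nhds (not_le.1 hj))] with s hs h
      exact absurd h (not_le.2 hs)
  obtain ⟨s, hs, hrs⟩ := (hev.and self_mem_nhdsWithin).exists
  obtain ⟨t, ht, hts⟩ := exists_lt_of_csInf_lt hne (lt_of_le_of_lt h hrs)
  refine (ht.2.trans (neighbourCount_mono x i hts.le)).trans ?_
  exact Nat.card_le_card_of_injective (fun j => ⟨j.1, j.2.1, hs j.1 j.2.2⟩)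
    fun _ _ h => Subtype.ext (congrArg (·.1) h)

/-- With too few points the defining set is empty and `sInf ∅ = 0`. -/
theorem knnRadius_eq_zero_of_le {k : ℕ} (hk : N ≤ k) (x : Fin N → X) (i : Fin N) :
    knnRadius k x i = 0 := by
  have : {r : ℝ | 0 ≤ r ∧ k ≤ neighbourCount x i r} = ∅ := by
    ext r
    have := neighbourCount_lt x i r
    simp only [Set.mem_ofPred_eq, Set.mem_empty_iff_false, iff_false, not_and]
    omega
  exact (congrArg sInf this).trans Real.sInf_empty

variable [MeasurableSpace X] [OpensMeasurableSpace X] [SecondCountableTopology X]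

theorem measurable_neighbourCount (i : Fin N) (r : ℝ) :
    Measurable fun x : Fin N → X => neighbourCount x i r := by
  classical
  simp only [neighbourCount_eq_sum]
  refine Finset.measurable_sum _ fun j _ => Measurable.ite ?_ measurable_const measurable_const
  by_cases hj : j = i
  · simp [hj]
  · simp only [ne_eq, hj, not_false_eq_true, true_and]
    exact measurableSet_le (by fun_prop) measurable_const

theorem measurable_knnRadius (k : ℕ) (i : Fin N) :
    Measurable fun x : Fin N → X => knnRadius k x i := by
  by_cases hk : k < N
  · refine measurable_of_Iic fun r => ?_
    by_cases hr : 0 ≤ r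
    · have : (fun x : Fin N → X => knnRadius k x i) ⁻¹' Set.Iic r =
          {x | k ≤ neighbourCount x i r} := by
        ext x; exact knnRadius_le_iff hk x i hr
      rw [this]
      exact measurableSet_le measurable_const (measurable_neighbourCount i r)
    · convert MeasurableSet.empty
      ext x
      simpa using (not_le.1 hr).trans_le (knnRadius_nonneg k x i)
  · simp only [knnRadius_eq_zero_of_le (not_lt.1 hk)]
    exact measurable_const

theorem measurable_weightMass (k : ℕ) (τ : ℝ) {A : Set X} (hA : MeasurableSet A) :
    Measurable fun x : Fin N → X => weightMass k τ x A := by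
  classical
  have hm := fun i => measurable_knnRadius (X := X) (N := N) k i
  unfold weightMass weight
  refine Finset.measurable_sum _ fun i _ => ?_
  simp only [Set.indicator_apply]
  exact Measurable.ite ((measurable_pi_apply i) hA) (by fun_prop) measurable_const

end Count

/-! ### Chernoff bounds for neighbour counts -/

section Chernoff

variable {X : Type*} [MeasurableSpace X]

-- The moment generating function of a Bernoulli variable is `1 + (exp s - 1) * q`, and `1 + y ≤ exp
-- y`.
open Classical in
theorem integral_exp_indicator_le (μ : Measure X) [IsProbabilityMeasure μ] {A : Set X}
    (hA : MeasurableSet A) (s : ℝ) :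
    ∫ x, Real.exp (s * if x ∈ A then 1 else 0) ∂μ ≤ Real.exp ((Real.exp s - 1) * μ.real A) := by
  have h1 : (fun x => Real.exp (s * if x ∈ A then 1 else 0)) =
      fun x => 1 + A.indicator (fun _ => Real.exp s - 1) x := by
    funext x
    by_cases hx : x ∈ A <;> simp [hx]
  rw [h1, integral_add (integrable_const _) ((integrable_const _).indicator hA),
    integral_indicator_const _ hA]
  simp only [integral_const, probReal_univ, smul_eq_mul, one_mul]
  have := Real.add_one_le_exp ((Real.exp s - 1) * μ.real A)
  linarith

-- The factor `s` on both sides lets one statement cover both tails: the upper one for `s > 0`, the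
-- lower one for `s < 0`.
open Classical in
theorem chernoff_pi {n : ℕ} (μ : Fin n → Measure X) [∀ j, IsProbabilityMeasure (μ j)]
    {A : Set X} (hA : MeasurableSet A) (s a : ℝ) :
    Measure.pi μ {b | s * a ≤ s * ∑ j, if b j ∈ A then 1 else 0} ≤
      ENNReal.ofReal (Real.exp ((Real.exp s - 1) * ∑ j, (μ j).real A - s * a)) := by
  let Y : (Fin n → X) → ℝ := fun b => s * ∑ j, if b j ∈ A then 1 else 0
  have hprod : (fun b => Real.exp (1 * Y b)) =
      fun b : Fin n → X => ∏ j, Real.exp (s * if b j ∈ A then 1 else 0) := by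
    funext b
    rw [one_mul, ← Real.exp_sum, ← Finset.mul_sum]
  have hmeas : Measurable fun x : X => Real.exp (s * if x ∈ A then (1 : ℝ) else 0) :=
    ((Measurable.ite hA measurable_const measurable_const).const_mul s).exp
  have hint : Integrable (fun b => Real.exp (1 * Y b)) (Measure.pi μ) := by
    rw [hprod]
    refine Integrable.fintype_prod (f := fun _ x => Real.exp (s * if x ∈ A then 1 else 0))
      fun j => ?_
    refine Integrable.of_bound hmeas.aestronglyMeasurable (Real.exp |s|)
      (Eventually.of_forall fun x => ?_)
    rw [Real.norm_of_nonneg (Real.exp_pos _).le, Real.exp_le_exp]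
    split_ifs
    · simpa using le_abs_self s
    · simp
  have h1 := measure_ge_le_exp_mul_mgf (s * a) zero_le_one hint
  have h2 : mgf Y (Measure.pi μ) 1 ≤ Real.exp ((Real.exp s - 1) * ∑ j, (μ j).real A) := by
    rw [mgf, hprod, integral_fintype_prod_eq_prod
      (fun _ x => Real.exp (s * if x ∈ A then 1 else 0)), Finset.mul_sum, Real.exp_sum]
    exact Finset.prod_le_prod (fun j _ => integral_nonneg fun x => (Real.exp_pos _).le)
      fun j _ => integral_exp_indicator_le (μ j) hA s
  rw [← ofReal_measureReal]
  refine ENNReal.ofReal_le_ofReal (h1.trans ?_)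
  calc Real.exp (-1 * (s * a)) * mgf Y (Measure.pi μ) 1
      ≤ Real.exp (-1 * (s * a)) * Real.exp ((Real.exp s - 1) * ∑ j, (μ j).real A) := by gcongr
    _ = _ := by rw [← Real.exp_add]; congr 1; ring

/-- Fubini in the form of conditioning on the position `a` of particle `i`. -/
theorem pi_apply_insertNth {n : ℕ} (μ : Fin (n + 1) → Measure X) [∀ j, IsProbabilityMeasure (μ j)]
    (i : Fin (n + 1)) {B : Set (Fin (n + 1) → X)} (hB : MeasurableSet B) :
    Measure.pi μ B =
      ∫⁻ a, Measure.pi (fun j => μ (i.succAbove j)) {b | i.insertNth a b ∈ B} ∂μ i := by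
  have h := (measurePreserving_piFinSuccAbove μ i).symm
  rw [← h.measure_preimage hB.nullMeasurableSet, Measure.prod_apply]
  · rfl
  · exact h.measurable hB

end Chernoff

/-- The number of indices with label `c`. -/
def labelCount {N C : ℕ} (lab : Fin N → Fin C) (c : Fin C) : ℕ :=
  Nat.card {j : Fin N // lab j = c}

theorem labelCount_eq_sum {N C : ℕ} (lab : Fin N → Fin C) (c : Fin C) :
    (labelCount lab c : ℝ) = ∑ j, if lab j = c then 1 else 0 := by
  rw [labelCount, Nat.card_eq_fintype_card, Fintype.card_subtype, Finset.card_filter]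
  push_cast
  rfl

/-- The averaged Chernoff bound for the number of neighbours within distance `r`, when `n`
neighbours and the centre have law `u`. -/
def chernoffBound {X : Type*} [PseudoMetricSpace X] [MeasurableSpace X] (u : Measure X)
    (n k s r : ℝ) : ℝ≥0∞ :=
  ∫⁻ a, min 1 (ENNReal.ofReal
    (Real.exp ((Real.exp s - 1) * (n * u.real (Metric.closedBall a r)) - s * k))) ∂u

section

variable {X : Type*} [MetricSpace X] [MeasurableSpace X] [BorelSpace X]
  [SecondCountableTopology X] {C : ℕ} {p : ℕ} {V : ℝ} {comp : Fin C → Set X} {u : Fin C → Measure X}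
  {σ : Fin C → ℝ}

open Classical in
theorem neighbourCount_insertNth {n : ℕ} (i : Fin (n + 1)) (a : X) (b : Fin n → X) (r : ℝ) :
    (neighbourCount (i.insertNth a b : Fin (n + 1) → X) i r : ℝ) =
      ∑ j, if b j ∈ Metric.closedBall a r then 1 else 0 := by
  rw [neighbourCount_eq_sum, Fin.sum_univ_succAbove _ i]
  push_cast
  simp [dist_comm a]

/-- Given `x i = a`, the count is a sum of independent indicators. Hypothesis `hs` allows particles
of other labels to be dropped from the exponent: for `s < 0` it is automatic, for `s > 0` it holds
if the ball misses the other components. -/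
theorem pi_neighbourCount_le {N : ℕ} (lab : Fin N → Fin C) [∀ c, IsProbabilityMeasure (u c)]
    (hmem : ∀ c, ∀ᵐ x ∂u c, x ∈ comp c) (i : Fin N) (k : ℕ) (s r : ℝ)
    (hs : ∀ a ∈ comp (lab i), ∀ c, c ≠ lab i →
      (Real.exp s - 1) * (u c).real (Metric.closedBall a r) ≤ 0) :
    Measure.pi (fun j => u (lab j)) {x | s * k ≤ s * neighbourCount x i r} ≤
      chernoffBound (u (lab i)) ((labelCount lab (lab i) : ℝ) - 1) k s r := by
  classical
  rcases N with _ | n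
  · exact i.elim0
  rw [pi_apply_insertNth _ i]
  swap
  · exact measurableSet_le measurable_const
      (((measurable_from_top (f := fun n : ℕ => (n : ℝ))).comp
        (measurable_neighbourCount (X := X) i r)).const_mul s)
  refine lintegral_mono_ae ?_
  filter_upwards [hmem (lab i)] with a ha
  refine le_min prob_le_one ?_
  have h1 := chernoff_pi (fun j => u (lab (i.succAbove j)))
    (Metric.isClosed_closedBall (x := a) (ε := r)).measurableSet s k
  simp only [neighbourCount_insertNth]
  refine h1.trans (ENNReal.ofReal_le_ofReal (Real.exp_le_exp.2 (sub_le_sub_right ?_ _)))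
  have h2 : (labelCount lab (lab i) : ℝ) - 1 =
      ∑ j, if lab (i.succAbove j) = lab i then 1 else 0 := by
    rw [labelCount_eq_sum, Fin.sum_univ_succAbove _ i, if_pos rfl]
    ring
  rw [h2, Finset.sum_mul, Finset.mul_sum, Finset.mul_sum]
  refine Finset.sum_le_sum fun j _ => ?_
  split_ifs with hj
  · rw [hj, one_mul]
  · rw [zero_mul, mul_zero]
    exact hs a ha _ hj

namespace IsUniformFamily

variable (hu : IsUniformFamily p V comp u σ)

include hu

theorem pi_le_neighbourCount_le {δ : ℝ}
    (hsep : ∀ a b, a ≠ b → ∀ x ∈ comp a, ∀ y ∈ comp b, δ < dist x y) {N : ℕ} (lab : Fin N → Fin C)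
    (i : Fin N) (k : ℕ) {s r : ℝ} (hs : 0 < s) (hr : r ≤ δ) :
    Measure.pi (fun j => u (lab j)) {x | k ≤ neighbourCount x i r} ≤
      chernoffBound (u (lab i)) ((labelCount lab (lab i) : ℝ) - 1) k s r := by
  have := hu.prob
  refine le_trans (measure_mono fun x hx => ?_)
    (pi_neighbourCount_le lab hu.ae_mem i k s r fun a ha c hc => ?_)
  · have hx : k ≤ neighbourCount x i r := hx
    exact mul_le_mul_of_nonneg_left (Nat.cast_le.2 hx) hs.le
  · have h0 : u c (Metric.closedBall a r) = 0 := by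
      refine measure_mono_null (t := {y | y ∉ comp c})
        (fun y hy (hyc : y ∈ comp c) => ?_) (ae_iff.1 (hu.ae_mem c))
      have h1 := hsep c (lab i) hc y hyc a ha
      have h2 := Metric.mem_closedBall.1 hy
      linarith
    rw [measureReal_def, h0]
    simp

theorem pi_neighbourCount_lt_le {N : ℕ} (lab : Fin N → Fin C)
    (i : Fin N) (k : ℕ) {s : ℝ} (r : ℝ) (hs : s < 0) :
    Measure.pi (fun j => u (lab j)) {x | neighbourCount x i r < k} ≤
      chernoffBound (u (lab i)) ((labelCount lab (lab i) : ℝ) - 1) k s r := by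
  have := hu.prob
  refine le_trans (measure_mono fun x hx => ?_)
    (pi_neighbourCount_le lab hu.ae_mem i k s r fun a ha c hc => ?_)
  · have hx : neighbourCount x i r < k := hx
    exact mul_le_mul_of_nonpos_left (Nat.cast_le.2 hx.le) hs.le
  · have h1 : Real.exp s ≤ 1 := Real.exp_le_one_iff.2 hs.le
    exact mul_nonpos_of_nonpos_of_nonneg (by linarith) measureReal_nonneg

theorem ae_pi_mem {N : ℕ} (lab : Fin N → Fin C) :
    ∀ᵐ x ∂Measure.pi (fun j => u (lab j)), ∀ j, x j ∈ comp (lab j) := by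
  have := hu.prob
  rw [ae_all_iff]
  intro j
  exact (Measure.tendsto_eval_ae_ae (μ := fun j => u (lab j)) (i := j)).eventually
    (hu.ae_mem (lab j))

/-- A tail bound for the nearest neighbour radius of a single particle. -/
theorem exists_pi_lt_knnRadius_le : ∃ κ > 0, ∀ {N : ℕ} (lab : Fin N → Fin C) (i : Fin N) (k : ℕ),
    k < labelCount lab (lab i) → ∀ r, 0 < r →
    Measure.pi (fun j => u (lab j)) {x | r < knnRadius k x i} ≤ ENNReal.ofReal
      (Real.exp (k - ((labelCount lab (lab i) : ℝ) - 1) * (κ * r ^ p))) := by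
  have := hu.prob
  obtain ⟨κ, hκ, D, hD, H⟩ := hu.lower
  refine ⟨κ / 2, by positivity, fun {N} lab i k hk r hr => ?_⟩
  have hkN : k < N := hk.trans_le
    ((Finite.card_subtype_le (fun j => lab j = lab i)).trans_eq (Nat.card_fin N))
  have hset : {x : Fin N → X | r < knnRadius k x i} = {x | neighbourCount x i r < k} := by
    ext x
    simp only [Set.mem_ofPred_eq]
    rw [← not_le, knnRadius_le_iff hkN x i hr.le, not_le]
  rw [hset]
  by_cases hrD : r ≤ D
  -- The choice `s = -1` gives `exp s - 1 ≤ -1 / 2`, the source of the factor in `κ / 2`.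
  · refine (hu.pi_neighbourCount_lt_le lab i k r (s := -1) (by norm_num)).trans ?_
    rw [chernoffBound]
    refine (lintegral_mono_ae (g := fun _ => ENNReal.ofReal (Real.exp (k -
      ((labelCount lab (lab i) : ℝ) - 1) * (κ / 2 * r ^ p)))) ?_).trans_eq (by simp)
    filter_upwards [hu.ae_mem (lab i)] with a ha
    refine (min_le_right _ _).trans (ENNReal.ofReal_le_ofReal (Real.exp_le_exp.2 ?_))
    have h1 := (H (lab i) a ha).2 r hr hrD
    have h2 : Real.exp (-1) ≤ 1 / 2 := by
      rw [Real.exp_neg, inv_eq_one_div]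
      exact one_div_le_one_div_of_le two_pos (by linarith [Real.add_one_le_exp (1 : ℝ)])
    have h3 : (1 : ℝ) ≤ labelCount lab (lab i) := by exact_mod_cast (Nat.zero_le k).trans_lt hk
    have h4 : ((labelCount lab (lab i) : ℝ) - 1) * (κ * r ^ p) ≤
        ((labelCount lab (lab i) : ℝ) - 1) * (u (lab i)).real (Metric.closedBall a r) :=
      mul_le_mul_of_nonneg_left h1 (by linarith)
    have h5 : 0 ≤ ((labelCount lab (lab i) : ℝ) - 1) * (κ * r ^ p) :=
      mul_nonneg (by linarith) (by positivity)
    nlinarith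
  -- Beyond `D` the ball contains the whole component, hence at least `k` neighbours, and the event
  -- is null.
  · refine (measure_mono_null (fun x hx hx' => ?_) (ae_iff.1 (hu.ae_pi_mem lab))).trans_le zero_le
    have hx : neighbourCount x i r < k := hx
    have h1 : labelCount lab (lab i) ≤ neighbourCount x i r + 1 :=
      card_label_le_neighbourCount fun j hj =>
        ((H (lab i) (x i) (hx' i)).1 (x j) (hj ▸ hx' j)).trans (not_le.1 hrD).le
    omega

end IsUniformFamily

end

/-- The radius around which the `k`-nearest neighbour distance of `N` particles concentrates. -/
def knnScale (p : ℕ) (V σ α : ℝ) (k N : ℕ) : ℝ :=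
  ((k : ℝ) * σ / (N * V * α)) ^ (1 / (p : ℝ))

theorem knnScale_pow {p : ℕ} (hp : 0 < p) {V σ α : ℝ} (hV : 0 < V) (hσ : 0 < σ) (hα : 0 < α)
    (k N : ℕ) : knnScale p V σ α k N ^ p = k * σ / (N * V * α) := by
  rw [knnScale, one_div, Real.rpow_inv_natCast_pow (by positivity) hp.ne']

theorem knnScale_pos {p : ℕ} {V σ α : ℝ} (hV : 0 < V) (hσ : 0 < σ) (hα : 0 < α)
    {k N : ℕ} (hk : 0 < k) (hN : 0 < N) : 0 < knnScale p V σ α k N :=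
  Real.rpow_pos_of_pos (by positivity) _

theorem tendsto_knnScale {p : ℕ} (hp : 0 < p) {V σ α : ℝ} {k : ℕ → ℕ}
    (hkN : Tendsto (fun N : ℕ => (k N : ℝ) / N) atTop (𝓝 0)) :
    Tendsto (fun N => knnScale p V σ α (k N) N) atTop (𝓝 0) := by
  have h1 : Tendsto (fun N : ℕ => (k N : ℝ) * σ / (N * V * α)) atTop (𝓝 0) := by
    have := hkN.mul_const (σ / (V * α))
    rw [zero_mul] at this
    refine this.congr fun N => ?_
    rw [div_mul_div_comm, mul_assoc]
  have h2 := h1.rpow_const (p := 1 / (p : ℝ)) (Or.inr (by positivity))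
  rwa [Real.zero_rpow (by positivity)] at h2

theorem measurable_measureReal_closedBall {X : Type*} [MetricSpace X] [MeasurableSpace X]
    [BorelSpace X] [SecondCountableTopology X] (u : Measure X) [IsFiniteMeasure u] (r : ℝ) :
    Measurable fun a => u.real (Metric.closedBall a r) := by
  refine Measurable.ennreal_toReal ?_
  have hs : MeasurableSet {q : X × X | dist q.2 q.1 ≤ r} :=
    measurableSet_le (by fun_prop) measurable_const
  exact measurable_measure_prodMk_left hs

/-! ### Concentration of the nearest neighbour radius. -/

namespace IsUniformFamily

variable {X : Type*} [MetricSpace X] [MeasurableSpace X] [BorelSpace X]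
  [SecondCountableTopology X] {C : ℕ} {p : ℕ} {V : ℝ} {comp : Fin C → Set X} {u : Fin C → Measure X}
  {σ : Fin C → ℝ} (hu : IsUniformFamily p V comp u σ) (hp : 0 < p) (hV : 0 < V)
  {k : ℕ → ℕ} (hk : Tendsto k atTop atTop)
  (hkN : Tendsto (fun N : ℕ => (k N : ℝ) / N) atTop (𝓝 0)) {lab : ∀ N : ℕ, Fin N → Fin C}
  {α : Fin C → ℝ} (hα : ∀ c, 0 < α c)
  (hlab : ∀ c, Tendsto (fun N : ℕ => (labelCount (lab N) c : ℝ) / N) atTop (𝓝 (α c)))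

include hu hp hV hk hkN hα hlab

/-- The expected count is about `N * α c * (V / σ c) * (ρ * R) ^ p`, and the scale `R` is chosen so
that this is `ρ ^ p * k`. -/
theorem tendsto_expected_neighbours (c : Fin C) {ρ : ℝ} (hρ : 0 < ρ) {a : X}
    (ha : Tendsto (fun r => (u c).real (Metric.closedBall a r) / r ^ p) (𝓝[>] 0) (𝓝 (V / σ c))) :
    Tendsto (fun N => ((labelCount (lab N) c : ℝ) - 1) *
      (u c).real (Metric.closedBall a (ρ * knnScale p V (σ c) (α c) (k N) N)) / k N)
      atTop (𝓝 (ρ ^ p)) := by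
  have hσ := hu.pos c
  have hαc := hα c
  have hr : Tendsto (fun N => ρ * knnScale p V (σ c) (α c) (k N) N) atTop (𝓝[>] 0) := by
    refine tendsto_nhdsWithin_iff.2 ⟨?_, ?_⟩
    · simpa using (tendsto_knnScale (V := V) (σ := σ c) (α := α c) hp hkN).const_mul ρ
    · filter_upwards [hk.eventually_gt_atTop 0, eventually_gt_atTop 0] with N h1 h2
      exact mul_pos hρ (knnScale_pos hV hσ hαc h1 h2)
  have h1 : Tendsto (fun N : ℕ => ((labelCount (lab N) c : ℝ) - 1) / N) atTop (𝓝 (α c)) := by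
    have := (hlab c).sub tendsto_one_div_atTop_nhds_zero_nat
    rw [sub_zero] at this
    exact this.congr fun N => by rw [sub_div]
  have h2 := (h1.mul (ha.comp hr)).mul_const (ρ ^ p * (σ c / (V * α c)))
  have e1 : α c * (V / σ c) * (ρ ^ p * (σ c / (V * α c))) = ρ ^ p := by field_simp
  rw [e1] at h2
  refine h2.congr' ?_
  filter_upwards [hk.eventually_gt_atTop 0, eventually_gt_atTop 0] with N hk0 hN0
  have hk0' : (0 : ℝ) < k N := by exact_mod_cast hk0
  have hN0' : (0 : ℝ) < N := by exact_mod_cast hN0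
  simp only [Function.comp_apply, mul_pow, knnScale_pow hp hV hσ hαc]
  field_simp

/-- With `θ = ρ ^ p`, the optimal parameter `s = -log θ` makes the exponent about `k * (1 - θ + log
θ)`, and `log θ < θ - 1` for `θ ≠ 1`. The density is known only pointwise almost everywhere; the
cutoff `min 1` permits dominated convergence. -/
theorem tendsto_chernoffBound (c : Fin C) {ρ : ℝ} (hρ : 0 < ρ) (hρ1 : ρ ≠ 1) :
    Tendsto (fun N => chernoffBound (u c) ((labelCount (lab N) c : ℝ) - 1) (k N)
      (-Real.log (ρ ^ p)) (ρ * knnScale p V (σ c) (α c) (k N) N)) atTop (𝓝 0) := by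
  have := hu.prob c
  set θ := ρ ^ p
  have hθ : 0 < θ := by positivity
  have hθ1 : θ ≠ 1 := fun h => hρ1 ((pow_eq_one_iff_of_nonneg hρ.le hp.ne').1 h)
  unfold chernoffBound
  rw [← lintegral_zero (μ := u c)]
  refine tendsto_lintegral_of_dominated_convergence (fun _ => 1) (fun N => ?_)
    (fun N => Eventually.of_forall fun a => min_le_left _ _) (by simp) ?_
  · exact measurable_const.min ((((measurable_measureReal_closedBall (u c) _).const_mul _).const_mul
      _).sub_const _).exp.ennreal_ofReal
  · filter_upwards [hu.density c] with a ha
    have h1 := hu.tendsto_expected_neighbours hp hV hk hkN hα hlab c hρ ha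
    have h2 := (h1.const_mul (Real.exp (-Real.log θ) - 1)).add_const (Real.log θ)
    have hneg : (Real.exp (-Real.log θ) - 1) * θ + Real.log θ < 0 := by
      rw [Real.exp_neg, Real.exp_log hθ, sub_mul, inv_mul_cancel₀ hθ.ne']
      linarith [Real.log_lt_sub_one_of_pos hθ hθ1]
    have h3 := h2.neg_mul_atTop hneg (tendsto_natCast_atTop_atTop (R := ℝ).comp hk)
    have h4 := ENNReal.tendsto_ofReal (Real.tendsto_exp_atBot.comp h3)
    rw [ENNReal.ofReal_zero] at h4
    refine tendsto_of_tendsto_of_tendsto_of_le_of_le' tendsto_const_nhds h4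
      (Eventually.of_forall fun N => zero_le) ?_
    filter_upwards [hk.eventually_gt_atTop 0] with N hk0
    have hk0' : (0 : ℝ) < k N := by exact_mod_cast hk0
    refine (min_le_right _ _).trans (ENNReal.ofReal_le_ofReal (Real.exp_le_exp.2 (le_of_eq ?_)))
    simp only [Function.comp_apply]
    field_simp
    ring

theorem eventually_lt_labelCount (c : Fin C) :
    ∀ᶠ N in atTop, k N < labelCount (lab N) c := by
  have h1 : ∀ᶠ N : ℕ in atTop, (k N : ℝ) / N < (labelCount (lab N) c : ℝ) / N :=
    hkN.eventually_lt (hlab c) (hα c)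
  filter_upwards [h1, eventually_gt_atTop 0] with N h hN
  have hN0' : (0 : ℝ) < N := by exact_mod_cast hN
  exact_mod_cast (div_lt_div_iff_of_pos_right hN0').1 h

/-- The bound is uniform in `i` because the Chernoff bound depends on `i` only through its label. -/
theorem eventually_pi_knnRadius_le (c : Fin C) {η : ℝ} (hη : 0 < η) {ε : ℝ≥0∞} (hε : 0 < ε) :
    ∀ᶠ N in atTop, ∀ i, lab N i = c → Measure.pi (fun j => u (lab N j))
      {x | η ≤ |knnRadius (k N) x i / knnScale p V (σ c) (α c) (k N) N - 1|} ≤ ε := by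
  -- The event shrinks as `η` grows; `η < 1` keeps the lower radius `(1 - η) * R` positive.
  wlog hη1 : η < 1 generalizing η
  · filter_upwards [this one_half_pos one_half_lt_one] with N hN i hi
    refine le_trans (measure_mono fun x hx => ?_) (hN i hi)
    have hx : η ≤ |knnRadius (k N) x i / knnScale p V (σ c) (α c) (k N) N - 1| := hx
    exact le_trans (by linarith) hx
  obtain ⟨δ, hδ, hsep⟩ := hu.separated
  -- The upper factor is `1 + η / 2` instead of `1 + η` because a count below `k` requires a radius
  -- strictly larger than the tested one.
  have h1 := hu.tendsto_chernoffBound hp hV hk hkN hα hlab c (ρ := 1 + η / 2) (by positivity)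
    (by linarith)
  have h2 := hu.tendsto_chernoffBound hp hV hk hkN hα hlab c (ρ := 1 - η) (by linarith)
    (by linarith)
  have hr : Tendsto (fun N => (1 - η) * knnScale p V (σ c) (α c) (k N) N) atTop (𝓝 0) := by
    simpa using (tendsto_knnScale (V := V) (σ := σ c) (α := α c) hp hkN).const_mul (1 - η)
  have hε2 : 0 < ε / 2 := ENNReal.half_pos hε.ne'
  filter_upwards [h1.eventually (ge_mem_nhds hε2), h2.eventually (ge_mem_nhds hε2),
    hr.eventually (ge_mem_nhds hδ), hk.eventually_gt_atTop 0, eventually_gt_atTop 0,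
    hu.eventually_lt_labelCount hp hV hk hkN hα hlab c] with N hN1 hN2 hNδ hk0 hN0 hkl i hi
  have hkN' : k N < N := hkl.trans_le
    ((Finite.card_subtype_le (fun j => lab N j = c)).trans_eq (Nat.card_fin N))
  have hR : 0 < knnScale p V (σ c) (α c) (k N) N := knnScale_pos hV (hu.pos c) (hα c) hk0 hN0
  set R := knnScale p V (σ c) (α c) (k N) N
  subst hi
  have hs1 : -Real.log ((1 + η / 2) ^ p) < 0 :=
    neg_lt_zero.2 (Real.log_pos (one_lt_pow₀ (by linarith) hp.ne'))
  have hs2 : 0 < -Real.log ((1 - η) ^ p) := neg_pos.2 (Real.log_neg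
    (pow_pos (by linarith) _) (pow_lt_one₀ (by linarith) (by linarith) hp.ne'))
  have b1 := (hu.pi_neighbourCount_lt_le (lab N) i (k N) ((1 + η / 2) * R) hs1).trans hN1
  have b2 := (hu.pi_le_neighbourCount_le hsep (lab N) i (k N) hs2 hNδ).trans hN2
  refine le_trans (measure_mono fun x hx => ?_) ((measure_union_le _ _).trans
    ((add_le_add b1 b2).trans_eq (ENNReal.add_halves ε)))
  have hx : η ≤ |knnRadius (k N) x i / R - 1| := hx
  rcases le_abs.1 hx with h | h
  · left
    have h3 : (1 + η / 2) * R < knnRadius (k N) x i := by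
      rw [← lt_div_iff₀ hR]; linarith
    exact not_le.1 fun h4 => not_le.2 h3 ((knnRadius_le_iff hkN' x i (by positivity)).2 h4)
  · right
    have h3 : knnRadius (k N) x i ≤ (1 - η) * R := by
      rw [← div_le_iff₀ hR]; linarith
    exact (knnRadius_le_iff hkN' x i ((knnRadius_nonneg _ _ _).trans h3)).1 h3

end IsUniformFamily

/-! ### Tails, moments and `L¹` convergence of the rescaled radii. -/

theorem lintegral_rpow_exp_lt_top {p : ℕ} (hp : 0 < p) {b q : ℝ} (hb : 0 < b) (hq : 0 < q) :
    ∫⁻ t in Set.Ioi (0 : ℝ), ENNReal.ofReal (Real.exp (1 - b * t ^ p)) *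
      ENNReal.ofReal (t ^ (q - 1)) < ∞ := by
  have h := (integrableOn_rpow_mul_exp_neg_mul_rpow (p := (p : ℝ)) (s := q - 1) (b := b)
    (by linarith) (by exact_mod_cast hp) hb).const_mul (Real.exp 1)
  refine lt_of_le_of_lt (lintegral_mono fun t => le_of_eq ?_) h.lintegral_lt_top
  rw [← ENNReal.ofReal_mul (Real.exp_pos _).le, Real.rpow_natCast]
  congr 1
  rw [sub_eq_add_neg, Real.exp_add, neg_mul]
  ring

namespace IsUniformFamily

variable {X : Type*} [MetricSpace X] [MeasurableSpace X] [BorelSpace X]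
  [SecondCountableTopology X] {C : ℕ} {p : ℕ} {V : ℝ} {comp : Fin C → Set X} {u : Fin C → Measure X}
  {σ : Fin C → ℝ} (hu : IsUniformFamily p V comp u σ) (hp : 0 < p) (hV : 0 < V)
  {k : ℕ → ℕ} (hk : Tendsto k atTop atTop)
  (hkN : Tendsto (fun N : ℕ => (k N : ℝ) / N) atTop (𝓝 0)) {lab : ∀ N : ℕ, Fin N → Fin C}
  {α : Fin C → ℝ} (hα : ∀ c, 0 < α c)
  (hlab : ∀ c, Tendsto (fun N : ℕ => (labelCount (lab N) c : ℝ) / N) atTop (𝓝 (α c)))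

include hu hp hV hk hkN hα hlab

/-- For large `N` the label count minus one is at least `N * α c / 2`, so by the choice of scale the
exponent in the tail bound is at most `k * (1 - b * t ^ p)`. -/
theorem exists_tail_bound (c : Fin C) : ∃ b > 0, ∀ᶠ N in atTop, ∀ i, lab N i = c → ∀ t, 0 < t →
    Measure.pi (fun j => u (lab N j))
      {x | t < knnRadius (k N) x i / knnScale p V (σ c) (α c) (k N) N} ≤
        ENNReal.ofReal (Real.exp (1 - b * t ^ p)) := by
  obtain ⟨κ, hκ, H⟩ := hu.exists_pi_lt_knnRadius_le
  have hσ := hu.pos c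
  have hαc := hα c
  have h1 : Tendsto (fun N : ℕ => ((labelCount (lab N) c : ℝ) - 1) / N) atTop (𝓝 (α c)) := by
    have := (hlab c).sub tendsto_one_div_atTop_nhds_zero_nat
    rw [sub_zero] at this
    exact this.congr fun N => by rw [sub_div]
  refine ⟨κ * σ c / (2 * V), by positivity, ?_⟩
  filter_upwards [h1.eventually (le_mem_nhds (half_lt_self hαc)), hk.eventually_gt_atTop 0,
    eventually_gt_atTop 0, hu.eventually_lt_labelCount hp hV hk hkN hα hlab c]
    with N hN hk0 hN0 hkl i hi t ht
  have := hu.prob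
  have hk1 : (1 : ℝ) ≤ k N := by exact_mod_cast hk0
  have hN0' : (0 : ℝ) < N := by exact_mod_cast hN0
  have hR : 0 < knnScale p V (σ c) (α c) (k N) N := knnScale_pos hV hσ hαc hk0 hN0
  have hRp := knnScale_pow hp hV hσ hαc (k N) N
  set R := knnScale p V (σ c) (α c) (k N) N
  set y := κ * σ c / (2 * V) * t ^ p with hy
  -- If `y ≤ 1` the bound is at least `1`; if `y > 1`, then `k * (1 - y) ≤ 1 - y` because `k ≥ 1`.
  by_cases hy1 : y ≤ 1
  · refine prob_le_one.trans ?_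
    rw [← ENNReal.ofReal_one]
    exact ENNReal.ofReal_le_ofReal (Real.one_le_exp (by linarith))
  · push Not at hy1
    subst hi
    have h2 := H (lab N) i (k N) hkl (t * R) (by positivity)
    simp only [lt_div_iff₀ hR]
    refine h2.trans (ENNReal.ofReal_le_ofReal (Real.exp_le_exp.2 ?_))
    have h3 : (k N : ℝ) * y ≤ ((labelCount (lab N) (lab N i) : ℝ) - 1) * (κ * (t * R) ^ p) := by
      have e1 : ((labelCount (lab N) (lab N i) : ℝ) - 1) * (κ * (t * R) ^ p) =
          (((labelCount (lab N) (lab N i) : ℝ) - 1) / N) *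
            (κ * t ^ p * (k N * σ (lab N i) / (V * α (lab N i)))) := by
        rw [mul_pow, hRp]; field_simp
      have e2 : (k N : ℝ) * y = α (lab N i) / 2 *
          (κ * t ^ p * (k N * σ (lab N i) / (V * α (lab N i)))) := by
        rw [hy]; field_simp
      rw [e1, e2]
      gcongr
    nlinarith

theorem exists_moment_bound (c : Fin C) {q : ℝ} (hq : 0 < q) : ∃ B : ℝ≥0∞, B ≠ ∞ ∧
    ∀ᶠ N in atTop, ∀ i, lab N i = c → ∫⁻ x, ENNReal.ofReal
      ((knnRadius (k N) x i / knnScale p V (σ c) (α c) (k N) N) ^ q)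
        ∂Measure.pi (fun j => u (lab N j)) ≤ B := by
  obtain ⟨b, hb, H⟩ := hu.exists_tail_bound hp hV hk hkN hα hlab c
  refine ⟨_, (ENNReal.mul_lt_top (ENNReal.ofReal_lt_top (r := q))
    (lintegral_rpow_exp_lt_top hp hb hq)).ne, ?_⟩
  filter_upwards [H, hk.eventually_gt_atTop 0, eventually_gt_atTop 0] with N hN hk0 hN0 i hi
  have hR : 0 < knnScale p V (σ c) (α c) (k N) N := knnScale_pos hV (hu.pos c) (hα c) hk0 hN0
  rw [lintegral_rpow_eq_lintegral_meas_lt_mul _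
    (Eventually.of_forall fun x => div_nonneg (knnRadius_nonneg _ _ _) hR.le)
    ((measurable_knnRadius _ _).div_const _).aemeasurable hq]
  gcongr 1
  refine setLIntegral_mono' measurableSet_Ioi fun t ht => ?_
  gcongr
  exact hN i hi t ht

/-- Convergence in probability and a bounded moment of order `2 * τ` give uniform integrability,
hence `L¹` convergence of the `τ`-th powers. -/
theorem eventually_lintegral_abs_le (c : Fin C) {τ : ℝ} (hτ : 0 < τ) {ε : ℝ} (hε : 0 < ε) :
    ∀ᶠ N in atTop, ∀ i, lab N i = c → ∫⁻ x, ENNReal.ofReal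
      |(knnRadius (k N) x i / knnScale p V (σ c) (α c) (k N) N) ^ τ - 1|
        ∂Measure.pi (fun j => u (lab N j)) ≤ ENNReal.ofReal ε := by
  obtain ⟨B, hB, hmom⟩ := hu.exists_moment_bound hp hV hk hkN hα hlab c (q := 2 * τ)
    (by positivity)
  -- Three errors of `ε / 3`. Off the bad event, continuity of the power suffices. On it, `z = |Y ^
  -- τ - 1|` is at most `T + z ^ 2 / T`: the first term is paid for by the probability `ε / (3 *
  -- T)`, the second by `(B + 1) / T = ε / 3`.
  set T : ℝ := 3 * (B.toReal + 1) / ε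
  have hT : 0 < T := by positivity
  obtain ⟨η, hη, hcont⟩ := Metric.continuousAt_iff.1
    (Real.continuousAt_rpow_const 1 τ (Or.inl one_ne_zero)) (ε / 3) (by positivity)
  filter_upwards [hmom, hk.eventually_gt_atTop 0, eventually_gt_atTop 0,
    hu.eventually_pi_knnRadius_le hp hV hk hkN hα hlab c hη (ε := ENNReal.ofReal (ε / 3 / T))
      (ENNReal.ofReal_pos.2 (by positivity))] with N hN hk0 hN0 hbad i hi
  have := hu.prob
  have hR : 0 < knnScale p V (σ c) (α c) (k N) N := knnScale_pos hV (hu.pos c) (hα c) hk0 hN0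
  set R := knnScale p V (σ c) (α c) (k N) N
  set Q := Measure.pi (fun j => u (lab N j))
  set Y : (Fin N → X) → ℝ := fun x => knnRadius (k N) x i / R
  have hY0 : ∀ x, 0 ≤ Y x := fun x => div_nonneg (knnRadius_nonneg _ _ _) hR.le
  have hYm : Measurable Y := (measurable_knnRadius _ _).div_const _
  have hbm : MeasurableSet {x | η ≤ |Y x - 1|} :=
    measurableSet_le measurable_const (hYm.sub_const 1).abs
  have hpt : ∀ x, ENNReal.ofReal |Y x ^ τ - 1| ≤ ENNReal.ofReal (ε / 3) +
      (({x | η ≤ |Y x - 1|}.indicator (fun _ => ENNReal.ofReal T) x) +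
        ENNReal.ofReal T⁻¹ * (ENNReal.ofReal (Y x ^ (2 * τ)) + 1)) := by
    intro x
    by_cases hx : η ≤ |Y x - 1|
    · have h1 : |Y x ^ τ - 1| ≤ T + T⁻¹ * (Y x ^ (2 * τ) + 1) := by
        have e1 : Y x ^ (2 * τ) = (Y x ^ τ) ^ 2 := by
          rw [mul_comm, Real.rpow_mul (hY0 x), Real.rpow_two]
        have h0 : 0 ≤ Y x ^ τ := Real.rpow_nonneg (hY0 x) τ
        have h2 : |Y x ^ τ - 1| ^ 2 ≤ Y x ^ (2 * τ) + 1 := by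
          rw [sq_abs, e1]; nlinarith
        have h3 : |Y x ^ τ - 1| * T ≤ T ^ 2 + |Y x ^ τ - 1| ^ 2 := by
          nlinarith [sq_nonneg (T - |Y x ^ τ - 1|), abs_nonneg (Y x ^ τ - 1)]
        rw [← mul_le_mul_iff_left₀ hT]
        calc _ ≤ T ^ 2 + (Y x ^ (2 * τ) + 1) := h3.trans (by gcongr)
          _ = _ := by field_simp
      rw [Set.indicator_of_mem (show x ∈ {x | η ≤ |Y x - 1|} from hx)]
      refine (ENNReal.ofReal_le_ofReal h1).trans (le_trans (le_of_eq ?_) le_add_self)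
      have h4 := Real.rpow_nonneg (hY0 x) (2 * τ)
      rw [ENNReal.ofReal_add hT.le (by positivity), ENNReal.ofReal_mul (by positivity),
        ENNReal.ofReal_add h4 zero_le_one, ENNReal.ofReal_one]
    · refine le_trans (ENNReal.ofReal_le_ofReal ?_) le_self_add
      have h1 := hcont (x := Y x) (by rw [Real.dist_eq]; exact not_le.1 hx)
      rw [Real.dist_eq, Real.one_rpow] at h1
      exact h1.le
  refine (lintegral_mono hpt).trans ?_
  rw [lintegral_add_left measurable_const, lintegral_add_left (measurable_const.indicator hbm),
    lintegral_const_mul' _ _ ENNReal.ofReal_ne_top, lintegral_add_right _ measurable_const,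
    lintegral_indicator_const hbm]
  simp only [lintegral_const, measure_univ, mul_one]
  have hb1 : ENNReal.ofReal T * Q {x | η ≤ |Y x - 1|} ≤ ENNReal.ofReal (ε / 3) := by
    refine (mul_le_mul_right (hbad i hi) _).trans_eq ?_
    rw [← ENNReal.ofReal_mul hT.le]
    congr 1
    field_simp
  have hb2 : ENNReal.ofReal T⁻¹ * (∫⁻ x, ENNReal.ofReal (Y x ^ (2 * τ)) ∂Q + 1) ≤
      ENNReal.ofReal (ε / 3) := by
    have h1 : ∫⁻ x, ENNReal.ofReal (Y x ^ (2 * τ)) ∂Q + 1 ≤ ENNReal.ofReal (B.toReal + 1) := by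
      rw [ENNReal.ofReal_add ENNReal.toReal_nonneg zero_le_one, ENNReal.ofReal_toReal hB,
        ENNReal.ofReal_one]
      exact add_le_add_left (hN i hi) 1
    refine (mul_le_mul_right h1 _).trans_eq ?_
    rw [← ENNReal.ofReal_mul (by positivity)]
    congr 1
    simp only [T]
    field_simp
  calc _ ≤ ENNReal.ofReal (ε / 3) + (ENNReal.ofReal (ε / 3) + ENNReal.ofReal (ε / 3)) := by
        gcongr
    _ = ENNReal.ofReal ε := by
        rw [← ENNReal.ofReal_add (by positivity) (by positivity),
          ← ENNReal.ofReal_add (by positivity) (by positivity)]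
        congr 1
        ring

end IsUniformFamily

/-! ### Component averages and the mean-field limit of the weights. -/

section Mean

variable {X : Type*} [PseudoMetricSpace X] {C N : ℕ}

/-- The contribution of label `c` to the average of the powers of the nearest neighbour radii,
measured in units of `R`. -/
def labelMean (k : ℕ) (τ R : ℝ) (lab : Fin N → Fin C) (c : Fin C) (x : Fin N → X) : ℝ :=
  (∑ i, if lab i = c then (knnRadius k x i / R) ^ τ else 0) / N

/-- Each component is measured in its own unit `R c`; the common factor `s`, which carries the
dependence on `N` in the application, cancels in the normalization. -/
theorem weightMass_eq {comp : Fin C → Set X} {lab : Fin N → Fin C} {x : Fin N → X}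
    (hdisj : Pairwise fun a b => Disjoint (comp a) (comp b))
    (hx : ∀ i, x i ∈ comp (lab i)) (hN : 0 < N) (k : ℕ) (τ : ℝ) {R w : Fin C → ℝ}
    (hR : ∀ c, 0 < R c) {s : ℝ} (hs : 0 < s) (hRw : ∀ c, R c ^ τ = s * w c) (c : Fin C) :
    weightMass k τ x (comp c) = w c * labelMean k τ (R c) lab c x /
      ∑ a, w a * labelMean k τ (R a) lab a x := by
  classical
  have hN' : (0 : ℝ) < N := by exact_mod_cast hN
  have hpart : ∀ a, ∑ i, (if lab i = a then knnRadius k x i ^ τ else 0) =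
      s * N * (w a * labelMean k τ (R a) lab a x) := by
    intro a
    rw [labelMean]
    have h1 : ∀ i, (if lab i = a then knnRadius k x i ^ τ else 0) =
        s * w a * (if lab i = a then (knnRadius k x i / R a) ^ τ else 0) := by
      intro i
      split_ifs
      · rw [Real.div_rpow (knnRadius_nonneg _ _ _) (hR a).le, ← hRw,
          mul_div_cancel₀ _ (Real.rpow_pos_of_pos (hR a) τ).ne']
      · simp
    rw [Finset.sum_congr rfl fun i _ => h1 i, ← Finset.mul_sum]
    field_simp
  have htot : ∑ j, knnRadius k x j ^ τ =
      s * N * ∑ a, w a * labelMean k τ (R a) lab a x := by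
    rw [Finset.mul_sum, ← Finset.sum_congr rfl fun a _ => hpart a, Finset.sum_comm]
    simp
  have hind : ∀ i, (comp c).indicator (fun _ => weight k τ x i) (x i) =
      (if lab i = c then knnRadius k x i ^ τ else 0) / ∑ j, knnRadius k x j ^ τ := by
    intro i
    by_cases hi : lab i = c
    · rw [Set.indicator_of_mem (hi ▸ hx i), if_pos hi, weight]
    · rw [Set.indicator_of_notMem (Set.disjoint_left.1 (hdisj hi) (hx i)), if_neg hi, zero_div]
  rw [weightMass, Finset.sum_congr rfl fun i _ => hind i, ← Finset.sum_div, hpart, htot,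
    mul_div_mul_left _ _ (by positivity)]

theorem abs_labelMean_sub_le (k : ℕ) (τ R a : ℝ) (lab : Fin N → Fin C) (c : Fin C)
    (x : Fin N → X) :
    |labelMean k τ R lab c x - a| ≤
      (∑ i, if lab i = c then |(knnRadius k x i / R) ^ τ - 1| else 0) / N +
        |(labelCount lab c : ℝ) / N - a| := by
  have h1 : labelMean k τ R lab c x - (labelCount lab c : ℝ) / N =
      (∑ i, if lab i = c then (knnRadius k x i / R) ^ τ - 1 else 0) / N := by
    rw [labelMean, labelCount_eq_sum, ← sub_div, ← Finset.sum_sub_distrib]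
    congr 1
    refine Finset.sum_congr rfl fun i _ => ?_
    split_ifs <;> simp
  refine (abs_sub_le _ ((labelCount lab c : ℝ) / N) _).trans (add_le_add_left ?_ _)
  rw [h1, abs_div, Nat.abs_cast]
  gcongr
  refine (Finset.abs_sum_le_sum_abs _ _).trans (Finset.sum_le_sum fun i _ => ?_)
  split_ifs <;> simp

end Mean

namespace IsUniformFamily

variable {X : Type*} [MetricSpace X] [MeasurableSpace X] [BorelSpace X]
  [SecondCountableTopology X] {C : ℕ} {p : ℕ} {V : ℝ} {comp : Fin C → Set X} {u : Fin C → Measure X}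
  {σ : Fin C → ℝ} (hu : IsUniformFamily p V comp u σ)

include hu in
theorem pairwise_disjoint : Pairwise fun a b => Disjoint (comp a) (comp b) := by
  obtain ⟨δ, hδ, hsep⟩ := hu.separated
  intro a b hab
  refine Set.disjoint_left.2 fun x hxa hxb => ?_
  have := hsep a b hab x hxa x hxb
  rw [dist_self] at this
  exact lt_asymm hδ this

variable (hp : 0 < p) (hV : 0 < V)
  {k : ℕ → ℕ} (hk : Tendsto k atTop atTop)
  (hkN : Tendsto (fun N : ℕ => (k N : ℝ) / N) atTop (𝓝 0)) {lab : ∀ N : ℕ, Fin N → Fin C}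
  {α : Fin C → ℝ} (hα : ∀ c, 0 < α c)
  (hlab : ∀ c, Tendsto (fun N : ℕ => (labelCount (lab N) c : ℝ) / N) atTop (𝓝 (α c)))

include hu hp hV hk hkN hα hlab

/-- The radii are dependent, but the `L¹` bound on each summand bounds the mean of the average, and
Markov's inequality needs no independence. Half of `ζ` is reserved for the error of the label
frequency. -/
theorem eventually_pi_labelMean_le (c : Fin C) {τ : ℝ} (hτ : 0 < τ) {ζ : ℝ} (hζ : 0 < ζ) {ε : ℝ}
    (hε : 0 < ε) : ∀ᶠ N in atTop, Measure.pi (fun j => u (lab N j))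
      {x | ζ ≤ |labelMean (k N) τ (knnScale p V (σ c) (α c) (k N) N) (lab N) c x - α c|} ≤
        ENNReal.ofReal ε := by
  have hcount : ∀ᶠ N : ℕ in atTop, |(labelCount (lab N) c : ℝ) / N - α c| < ζ / 2 :=
    (hlab c).eventually (Metric.ball_mem_nhds _ (by positivity))
  filter_upwards [hu.eventually_lintegral_abs_le hp hV hk hkN hα hlab c hτ
    (ε := ζ / 2 * ε) (by positivity), hcount, eventually_gt_atTop 0] with N hN hc hN0
  have hN0' : (0 : ℝ) < N := by exact_mod_cast hN0
  set R := knnScale p V (σ c) (α c) (k N) N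
  set Q := Measure.pi (fun j => u (lab N j))
  let W : (Fin N → X) → ℝ≥0∞ := fun x =>
    ∑ i, if lab N i = c then ENNReal.ofReal |(knnRadius (k N) x i / R) ^ τ - 1| else 0
  have hm : ∀ i, Measurable fun x : Fin N → X =>
      ENNReal.ofReal |(knnRadius (k N) x i / R) ^ τ - 1| := fun i =>
    ((((measurable_knnRadius (k N) i).div_const R).pow_const τ).sub_const 1).abs.ennreal_ofReal
  have hm' : ∀ i, Measurable fun x : Fin N → X =>
      if lab N i = c then ENNReal.ofReal |(knnRadius (k N) x i / R) ^ τ - 1| else 0 := fun i => by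
    split_ifs
    · exact hm i
    · exact measurable_const
  have hint : ∫⁻ x, W x ∂Q ≤ N * ENNReal.ofReal (ζ / 2 * ε) := by
    rw [lintegral_finsetSum _ fun i _ => hm' i]
    calc _ ≤ ∑ _i : Fin N, ENNReal.ofReal (ζ / 2 * ε) := by
          refine Finset.sum_le_sum fun i _ => ?_
          split_ifs with hi
          · exact hN i hi
          · simp
      _ = _ := by simp
  have hsub : {x | ζ ≤ |labelMean (k N) τ R (lab N) c x - α c|} ⊆
      {x | ENNReal.ofReal (ζ / 2 * N) ≤ W x} := by
    intro x hx
    have hx : ζ ≤ |labelMean (k N) τ R (lab N) c x - α c| := hx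
    have h1 := abs_labelMean_sub_le (k N) τ R (α c) (lab N) c x
    have h2 : ζ / 2 ≤
        (∑ i, if lab N i = c then |(knnRadius (k N) x i / R) ^ τ - 1| else 0) / N := by linarith
    rw [le_div_iff₀ hN0'] at h2
    refine (ENNReal.ofReal_le_ofReal h2).trans_eq ?_
    rw [ENNReal.ofReal_sum_of_nonneg fun i _ => by split_ifs <;> positivity]
    refine Finset.sum_congr rfl fun i _ => ?_
    split_ifs <;> simp
  have hmarkov := mul_meas_ge_le_lintegral (μ := Q)
    (Finset.measurable_sum Finset.univ fun i _ => hm' i) (ENNReal.ofReal (ζ / 2 * N))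
  have hmul : ENNReal.ofReal (ζ / 2 * N) *
      Q {x | ζ ≤ |labelMean (k N) τ R (lab N) c x - α c|} ≤
        ENNReal.ofReal (ζ / 2 * N) * ENNReal.ofReal ε := by
    calc _ ≤ ENNReal.ofReal (ζ / 2 * N) * Q {x | ENNReal.ofReal (ζ / 2 * N) ≤ W x} := by gcongr
      _ ≤ ∫⁻ x, W x ∂Q := by simpa only [Finset.sum_apply, W] using hmarkov
      _ ≤ N * ENNReal.ofReal (ζ / 2 * ε) := hint
      _ = _ := by
        rw [← ENNReal.ofReal_natCast, ← ENNReal.ofReal_mul hN0'.le,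
          ← ENNReal.ofReal_mul (by positivity)]
        congr 1
        ring
  exact (ENNReal.mul_le_mul_iff_right (ENNReal.ofReal_pos.2 (by positivity)).ne'
    ENNReal.ofReal_ne_top).1 hmul

/-- With `w a = (σ a / α a) ^ β`, the weight mass is a function `G` of the component averages,
continuous at their limit `α`. Since `w a * α a = σ a ^ β * α a ^ (1 - β)` and the powers of `S`
cancel, `G α` is the mean-field map. -/
theorem tendsto_pi_weightMass (hC : Nonempty (Fin C)) {S : ℝ} (hS : 0 < S) (c : Fin C) {τ : ℝ}
    (hτ : 0 < τ) {η : ℝ} (hη : 0 < η) :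
    Tendsto (fun N => Measure.pi (fun j => u (lab N j))
      {x | η ≤ |weightMass (k N) τ x (comp c) -
        meanFieldMap (τ / (p : ℝ)) (fun a => σ a / S) α c|}) atTop (𝓝 0) := by
  set β := τ / (p : ℝ) with hβ
  set w : Fin C → ℝ := fun a => (σ a / α a) ^ β with hw
  have hw0 : ∀ a, 0 < w a := fun a => Real.rpow_pos_of_pos (div_pos (hu.pos a) (hα a)) β
  let G : (Fin C → ℝ) → ℝ := fun z => w c * z c / ∑ a, w a * z a
  have hden : 0 < ∑ a, w a * α a :=
    Finset.sum_pos (fun a _ => mul_pos (hw0 a) (hα a)) Finset.univ_nonempty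
  have hterm : ∀ a, α a ^ (1 - β) * (σ a / S) ^ β = (S ^ β)⁻¹ * (w a * α a) := by
    intro a
    simp only [hw]
    rw [Real.rpow_sub (hα a), Real.rpow_one, Real.div_rpow (hu.pos a).le hS.le,
      Real.div_rpow (hu.pos a).le (hα a).le]
    have := Real.rpow_pos_of_pos (hα a) β
    have := Real.rpow_pos_of_pos hS β
    field_simp
  have hG : meanFieldMap β (fun a => σ a / S) α c = G α := by
    simp only [meanFieldMap, hterm, ← Finset.mul_sum]
    rw [mul_div_mul_left _ _ (inv_ne_zero (Real.rpow_pos_of_pos hS β).ne')]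
  have hGc : ContinuousAt G α := by
    exact ((continuous_apply c).const_mul _).continuousAt.div (continuous_finsetSum _ fun a _ =>
      (continuous_apply a).const_mul _).continuousAt hden.ne'
  obtain ⟨ζ, hζ, hGζ⟩ := Metric.continuousAt_iff.1 hGc η hη
  rw [hG, ENNReal.tendsto_nhds_zero]
  intro ε hε
  -- The error is shared by the `C` components; `ε = ∞` is separate because its `toReal` is `0`.
  obtain ⟨e, he, heε⟩ : ∃ e : ℝ, 0 < e ∧ C * ENNReal.ofReal e ≤ ε := by
    have hC0 : (0 : ℝ) < C := by exact_mod_cast Fin.pos_iff_nonempty.2 hC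
    by_cases htop : ε = ∞
    · exact ⟨1, one_pos, htop ▸ le_top⟩
    · refine ⟨ε.toReal / C, div_pos (ENNReal.toReal_pos hε.ne' htop) hC0, ?_⟩
      rw [← ENNReal.ofReal_natCast, ← ENNReal.ofReal_mul hC0.le, mul_div_cancel₀ _ hC0.ne',
        ENNReal.ofReal_toReal htop]
  have hall := eventually_all.2 fun a =>
    hu.eventually_pi_labelMean_le hp hV hk hkN hα hlab a hτ hζ he
  filter_upwards [hall, hk.eventually_gt_atTop 0, eventually_gt_atTop 0] with N hN hk0 hN0
  have hk0' : (0 : ℝ) < k N := by exact_mod_cast hk0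
  have hN0' : (0 : ℝ) < N := by exact_mod_cast hN0
  set R : Fin C → ℝ := fun a => knnScale p V (σ a) (α a) (k N) N with hRdef
  have hR : ∀ a, 0 < R a := fun a => knnScale_pos hV (hu.pos a) (hα a) hk0 hN0
  have hRw : ∀ a, R a ^ τ = (k N / (N * V)) ^ β * w a := by
    intro a
    have := hu.pos a
    have := hα a
    simp only [hRdef, hw, knnScale]
    rw [← Real.rpow_mul (by positivity), one_div_mul_eq_div, ← hβ,
      ← Real.mul_rpow (by positivity) (by positivity), div_mul_div_comm]
  have hsub : {x : Fin N → X | η ≤ |weightMass (k N) τ x (comp c) - G α|} ⊆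
      {x | ¬ ∀ j, x j ∈ comp (lab N j)} ∪
        ⋃ a, {x | ζ ≤ |labelMean (k N) τ (R a) (lab N) a x - α a|} := by
    intro x hx
    by_contra hcon
    simp only [Set.mem_union, Set.mem_iUnion, not_or, not_exists, Set.mem_ofPred_eq, not_not,
      not_le] at hcon
    have h1 := weightMass_eq hu.pairwise_disjoint hcon.1 hN0 (k N) τ hR
      (Real.rpow_pos_of_pos (div_pos hk0' (mul_pos hN0' hV)) β) hRw c
    have h2 := hGζ (x := fun a => labelMean (k N) τ (R a) (lab N) a x)
      ((dist_pi_lt_iff hζ).2 hcon.2)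
    have h3 : weightMass (k N) τ x (comp c) =
      G fun a => labelMean (k N) τ (R a) (lab N) a x := h1
    rw [← h3, Real.dist_eq] at h2
    exact not_le.2 h2 hx
  refine (measure_mono hsub).trans ((measure_union_le _ _).trans ?_)
  rw [ae_iff.1 (hu.ae_pi_mem (lab N)), zero_add]
  refine (measure_iUnion_fintype_le _ _).trans ((Finset.sum_le_sum fun a _ => hN a).trans ?_)
  simpa using heε

end IsUniformFamily

/-! ### Resampling -/

section Resampling

variable {X : Type*} [PseudoMetricSpace X] {N : ℕ}

open Classical in
theorem fraction_eq_sum (y : Fin N → X) (A : Set X) :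
    fraction y A = (∑ i, if y i ∈ A then 1 else 0) / N := by
  rw [fraction, Nat.card_eq_fintype_card, Fintype.card_subtype, Finset.card_filter]
  push_cast
  rfl

theorem weight_nonneg (k : ℕ) (τ : ℝ) (x : Fin N → X) (i : Fin N) : 0 ≤ weight k τ x i :=
  div_nonneg (Real.rpow_nonneg (knnRadius_nonneg _ _ _) _)
    (Finset.sum_nonneg fun _ _ => Real.rpow_nonneg (knnRadius_nonneg _ _ _) _)

/-- The law of a single ancestor index in the resampling step. -/
def ancestorLaw (k : ℕ) (τ : ℝ) (x : Fin N → X) : Measure (Fin N) :=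
  ∑ i, ENNReal.ofReal (weight k τ x i) • Measure.dirac i

theorem ancestorLaw_apply (k : ℕ) (τ : ℝ) (x : Fin N → X) (B : Set (Fin N)) :
    ancestorLaw k τ x B = ∑ i, ENNReal.ofReal (weight k τ x i) * B.indicator 1 i := by
  rw [ancestorLaw, Measure.coe_finsetSum, Finset.sum_apply]
  simp

/-- If the sum of the powers vanishes, division by zero makes all weights `0` and the law is the
zero measure. -/
theorem ancestorLaw_eq_zero_or (k : ℕ) (τ : ℝ) (x : Fin N → X) :
    ancestorLaw k τ x = 0 ∨ IsProbabilityMeasure (ancestorLaw k τ x) := by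
  by_cases hS : ∑ j, knnRadius k x j ^ τ = 0
  · left
    refine Finset.sum_eq_zero fun i _ => ?_
    rw [weight, hS, div_zero, ENNReal.ofReal_zero, zero_smul]
  · right
    refine ⟨?_⟩
    rw [ancestorLaw_apply]
    simp only [Set.indicator_univ, Pi.one_apply, mul_one]
    rw [← ENNReal.ofReal_sum_of_nonneg fun i _ => weight_nonneg k τ x i]
    simp only [weight]
    rw [← Finset.sum_div, div_self hS, ENNReal.ofReal_one]

theorem resampleLaw_le_one (k : ℕ) (τ : ℝ) (x : Fin N → X) (B : Set (Fin N → Fin N)) :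
    resampleLaw k τ x B ≤ 1 := by
  change Measure.pi (fun _ => ancestorLaw k τ x) B ≤ 1
  rcases ancestorLaw_eq_zero_or k τ x with h | h
  · rw [h]
    refine (measure_mono (Set.subset_univ _)).trans ?_
    rw [Measure.pi_univ]
    exact Finset.prod_le_one' fun _ _ => by simp
  · exact prob_le_one

/-- Chebyshev's inequality for independent indicators with mean the weight mass. In the degenerate
case the product is the zero measure, since `N > 0`. -/
theorem resampleLaw_fraction_le (k : ℕ) (τ : ℝ) (x : Fin N → X) (A : Set X) (hN : 0 < N) {η : ℝ}
    (hη : 0 < η) : resampleLaw k τ x {I | η ≤ |fraction (fun j => x (I j)) A - weightMass k τ x A|} ≤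
      ENNReal.ofReal (1 / (N * η ^ 2)) := by
  classical
  have hN' : (0 : ℝ) < N := by exact_mod_cast hN
  change Measure.pi (fun _ => ancestorLaw k τ x) _ ≤ _
  have hρi := ancestorLaw_apply k τ x
  rcases ancestorLaw_eq_zero_or k τ x with hρ0 | hprob
  · rw [hρ0]
    refine (measure_mono (Set.subset_univ _)).trans ?_
    rw [Measure.pi_univ]
    simp [hN.ne']
  · set ρ := ancestorLaw k τ x
    let f : Fin N → ℝ := fun i => if x i ∈ A then 1 else 0
    have hfint : ∀ μ : Measure (Fin N), IsProbabilityMeasure μ → MemLp f 2 μ := fun μ _ =>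
      MemLp.of_bound (measurable_of_finite f).aestronglyMeasurable 1
        (Eventually.of_forall fun i => by simp only [f]; split_ifs <;> simp)
    have hmean : ∫ i, f i ∂ρ = weightMass k τ x A := by
      rw [integral_fintype ((hfint ρ hprob).integrable one_le_two), weightMass]
      refine Finset.sum_congr rfl fun i _ => ?_
      have : ρ.real {i} = weight k τ x i := by
        rw [measureReal_def, hρi, Finset.sum_eq_single i]
        · simp [weight_nonneg]
        · intro j _ hj
          simp [hj]
        · simp
      rw [this]
      simp only [f, Set.indicator_apply]
      split_ifs <;> simp
    have hvar : Var[f; ρ] ≤ 1 / 4 := by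
      refine (variance_le_sq_of_bounded (a := 0) (b := 1) (Eventually.of_forall fun i => ?_)
        (measurable_of_finite f).aemeasurable).trans (by norm_num)
      simp only [f]
      split_ifs <;> simp
    let F : (Fin N → Fin N) → ℝ := ∑ j : Fin N, fun I => f (I j)
    have hF : ∀ I, F I = N * fraction (fun j => x (I j)) A := by
      intro I
      rw [fraction_eq_sum, mul_div_cancel₀ _ hN'.ne']
      simp [F, f]
    have hFL : MemLp F 2 (Measure.pi fun _ => ρ) := by
      refine memLp_finsetSum' _ fun j _ => ?_
      exact (hfint ρ hprob).comp_measurePreserving (measurePreserving_eval (fun _ => ρ) j)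
    have hFmean : ∫ I, F I ∂Measure.pi (fun _ => ρ) = N * weightMass k τ x A := by
      simp only [F, Finset.sum_apply]
      rw [integral_finsetSum (f := fun j (I : Fin N → Fin N) => f (I j)) _ fun j _ =>
        (((hfint ρ hprob).comp_measurePreserving
          (measurePreserving_eval (fun _ => ρ) j)).integrable one_le_two)]
      have : ∀ j : Fin N, ∫ I : Fin N → Fin N, f (I j) ∂Measure.pi (fun _ => ρ) =
          weightMass k τ x A := fun j => by
        rw [← hmean]
        exact integral_comp_eval (μ := fun _ : Fin N => ρ) (i := j)
          (measurable_of_finite f).aestronglyMeasurable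
      simp [this]
    -- The sharper `N / 4` is not needed.
    have hFvar : Var[F; Measure.pi fun _ => ρ] ≤ N := by
      rw [variance_sum_pi fun _ => hfint ρ hprob]
      simp only [Finset.sum_const, Finset.card_univ, Fintype.card_fin, nsmul_eq_mul]
      nlinarith
    have hcheb := meas_ge_le_variance_div_sq hFL (c := N * η) (by positivity)
    rw [hFmean] at hcheb
    refine le_trans (measure_mono fun I hI => ?_) (hcheb.trans (ENNReal.ofReal_le_ofReal ?_))
    · have hI : η ≤ |fraction (fun j => x (I j)) A - weightMass k τ x A| := hI
      change N * η ≤ |F I - N * weightMass k τ x A|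
      rw [hF, ← mul_sub, abs_mul, Nat.abs_cast]
      gcongr
    · rw [div_le_div_iff₀ (by positivity) (by positivity)]
      have : 0 ≤ (N : ℝ) * η ^ 2 := by positivity
      nlinarith

end Resampling

/-! ### Total variation -/

theorem measure_le_add_tvDist {X : Type*} [MeasurableSpace X] (μ ν : Measure X)
    [IsProbabilityMeasure μ] [IsProbabilityMeasure ν] {B : Set X} (hB : MeasurableSet B) :
    μ B ≤ ν B + tvDist μ ν := by
  have h1 : ENNReal.ofReal |μ.real B - ν.real B| ≤ tvDist μ ν :=
    le_iSup₂ (f := fun (s : Set X) (_ : MeasurableSet s) =>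
      ENNReal.ofReal |μ.real s - ν.real s|) B hB
  refine le_trans ?_ (add_le_add_right h1 _)
  rw [← ofReal_measureReal (μ := μ), ← ofReal_measureReal (μ := ν),
    ← ENNReal.ofReal_add measureReal_nonneg (abs_nonneg _)]
  exact ENNReal.ofReal_le_ofReal (by linarith [le_abs_self (μ.real B - ν.real B)])

instance isMarkovKernel_particleKernel {X : Type*} [MeasurableSpace X] (K : Kernel X X)
    [IsMarkovKernel K] (N : ℕ) : IsMarkovKernel (particleKernel K N) :=
  ⟨fun y => inferInstanceAs (IsProbabilityMeasure (Measure.pi fun i => K (y i)))⟩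

instance isProbabilityMeasure_rejuvenatedLaw {X : Type*} [MeasurableSpace X] (K : Kernel X X)
    [IsMarkovKernel K] (M : ℕ) {N : ℕ} (ν : Measure (Fin N → X)) [IsProbabilityMeasure ν] :
    IsProbabilityMeasure (rejuvenatedLaw K M ν) :=
  inferInstanceAs (IsProbabilityMeasure (ν.bind (particleKernel (K ^ M) N)))

/-- The tolerance is halved: where the weight mass is within `η / 2` of `φ`, Chebyshev's inequality
applies conditionally on the particles; elsewhere the conditional probability is bounded by `1`. -/
theorem tendsto_lintegral_resampleLaw {X : Type*} [PseudoMetricSpace X] [MeasurableSpace X]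
    [OpensMeasurableSpace X] [SecondCountableTopology X] {P : ∀ N : ℕ, Measure (Fin N → X)}
    [∀ N, IsProbabilityMeasure (P N)] {A : Set X} (hA : MeasurableSet A) {k : ℕ → ℕ} {τ φ : ℝ}
    (hmass : ∀ η : ℝ, 0 < η →
      Tendsto (fun N => P N {x | η ≤ |weightMass (k N) τ x A - φ|}) atTop (𝓝 0))
    {η : ℝ} (hη : 0 < η) :
    Tendsto (fun N => ∫⁻ x, resampleLaw (k N) τ x {I | η ≤ |fraction (fun j => x (I j)) A - φ|}
      ∂P N) atTop (𝓝 0) := by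
  have hη2 : 0 < η / 2 := by positivity
  have h1 : Tendsto (fun N : ℕ => ENNReal.ofReal (1 / (N * (η / 2) ^ 2))) atTop (𝓝 0) := by
    have h2 := (tendsto_one_div_atTop_nhds_zero_nat (𝕜 := ℝ)).mul_const (1 / (η / 2) ^ 2)
    rw [zero_mul] at h2
    have h3 := ENNReal.tendsto_ofReal h2
    rw [ENNReal.ofReal_zero] at h3
    exact h3.congr fun N => by rw [div_mul_div_comm, one_mul]
  have h2 := h1.add (hmass (η / 2) hη2)
  rw [add_zero] at h2
  refine tendsto_of_tendsto_of_tendsto_of_le_of_le' tendsto_const_nhds h2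
    (Eventually.of_forall fun N => zero_le) ?_
  filter_upwards [eventually_gt_atTop 0] with N hN
  have hB : MeasurableSet {x : Fin N → X | η / 2 ≤ |weightMass (k N) τ x A - φ|} :=
    measurableSet_le measurable_const ((measurable_weightMass (k N) τ hA).sub_const φ).abs
  have hpt : ∀ x : Fin N → X,
      resampleLaw (k N) τ x {I | η ≤ |fraction (fun j => x (I j)) A - φ|} ≤
        ENNReal.ofReal (1 / (N * (η / 2) ^ 2)) +
          {x | η / 2 ≤ |weightMass (k N) τ x A - φ|}.indicator (fun _ => 1) x := by
    intro x
    by_cases hx : x ∈ {x | η / 2 ≤ |weightMass (k N) τ x A - φ|}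
    · rw [Set.indicator_of_mem hx]
      exact (resampleLaw_le_one _ _ _ _).trans le_add_self
    · refine le_trans (measure_mono fun I hI => ?_)
        ((resampleLaw_fraction_le (k N) τ x A hN hη2).trans le_self_add)
      have hI : η ≤ |fraction (fun j => x (I j)) A - φ| := hI
      have hx : |weightMass (k N) τ x A - φ| < η / 2 := not_le.1 hx
      change η / 2 ≤ |fraction (fun j => x (I j)) A - weightMass (k N) τ x A|
      have := abs_sub_le (fraction (fun j => x (I j)) A) (weightMass (k N) τ x A) φ
      linarith
  refine (lintegral_mono hpt).trans_eq ?_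
  rw [lintegral_add_left measurable_const, lintegral_indicator_const hB]
  simp

end MASEM

end

/-! ### The main theorem. -/

open MASEM in
theorem mainTheorem3 {d m l C : ℕ} (hmd : m < d)
    (h : Fin m → EuclideanSpace ℝ (Fin d) → ℝ) (g : Fin l → EuclideanSpace ℝ (Fin d) → ℝ)
    (hh : ∀ j, MASEM.IsSmoothConstraint (h j)) (hg : ∀ i, MASEM.IsSmoothConstraint (g i))
    (hlicq : MASEM.LICQ h g) (hbdd : Bornology.IsBounded (MASEM.feasibleSet h g))
    (comp : Fin C → Set (EuclideanSpace ℝ (Fin d)))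
    (hcomp : MASEM.IsComponentDecomposition (MASEM.feasibleSet h g) comp)
    -- the temperature and the number of neighbours
    (τ : ℝ) (hτ : 0 < τ) (k : ℕ → ℕ) (hk : Tendsto k atTop atTop)
    (hkN : Tendsto (fun N : ℕ => (k N : ℝ) / N) atTop (𝓝 0))
    -- the particle systems
    (K : Kernel (EuclideanSpace ℝ (Fin d)) (EuclideanSpace ℝ (Fin d))) [IsMarkovKernel K]
    (M : ℕ → ℕ) (lab : ∀ N : ℕ, Fin N → Fin C)
    (ν : ∀ N : ℕ, Measure (Fin N → EuclideanSpace ℝ (Fin d))) [∀ N, IsProbabilityMeasure (ν N)]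
    (hmix : MASEM.MixingRejuvenation (d - m) comp K M lab ν)
    -- the limiting component weights
    (α : Fin C → ℝ) (hα : α ∈ stdSimplex ℝ (Fin C)) (hαpos : ∀ c, 0 < α c)
    (hlab : ∀ c, Tendsto (fun N : ℕ => (Nat.card {i : Fin N // lab N i = c} : ℝ) / N)
      atTop (𝓝 (α c))) :
    -- concentration of the nearest neighbour radii
    (∀ c : Fin C, ∀ η : ℝ, 0 < η →
      Tendsto (fun N : ℕ => ⨆ i : Fin N, ⨆ _ : lab N i = c,
        MASEM.rejuvenatedLaw K (M N) (ν N)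
          {x | η ≤ |MASEM.knnRadius (k N) x i /
            ((k N : ℝ) * MASEM.vol (d - m) (comp c) /
              (N * MASEM.unitBallVol (d - m) * α c)) ^ (1 / ((d - m : ℕ) : ℝ)) - 1|})
        atTop (𝓝 0)) ∧
    -- the mass that the normalized weights give to each component
    (∀ c : Fin C, ∀ η : ℝ, 0 < η →
      Tendsto (fun N : ℕ => MASEM.rejuvenatedLaw K (M N) (ν N)
          {x | η ≤ |MASEM.weightMass (k N) τ x (comp c) -
            MASEM.meanFieldMap (τ / ((d - m : ℕ) : ℝ))
              (fun a => MASEM.vol (d - m) (comp a) / MASEM.vol (d - m) (MASEM.feasibleSet h g))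
              α c|})
        atTop (𝓝 0)) ∧
    -- the fraction of the resampled particles in each component
    (∀ c : Fin C, ∀ η : ℝ, 0 < η →
      Tendsto (fun N : ℕ => ∫⁻ x, MASEM.resampleLaw (k N) τ x
          {I | η ≤ |MASEM.fraction (fun j => x (I j)) (comp c) -
            MASEM.meanFieldMap (τ / ((d - m : ℕ) : ℝ))
              (fun a => MASEM.vol (d - m) (comp a) / MASEM.vol (d - m) (MASEM.feasibleSet h g))
              α c|}
          ∂(MASEM.rejuvenatedLaw K (M N) (ν N)))
        atTop (𝓝 0)) := by

  set p := d - m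
  have hp : 0 < p := Nat.sub_pos_of_lt hmd
  have hV := unitBallVol_pos p
  have hu := isUniformFamily_uniformOn hmd hh hg hlicq hbdd hcomp
  have hprob := hu.prob
  have hlab' : ∀ c, Tendsto (fun N : ℕ => (labelCount (lab N) c : ℝ) / N) atTop (𝓝 (α c)) := hlab
  -- An empty sum of component weights could not equal `1`.
  have hC : Nonempty (Fin C) := by
    by_contra hC
    rw [not_nonempty_iff] at hC
    simpa using hα.2
  have hS : 0 < vol p (feasibleSet h g) := by
    refine (hu.pos hC.some).trans_le (ENNReal.toReal_mono
      (measure_feasibleSet_lt_top hh hg hlicq hbdd).ne (measure_mono (hcomp.subset _)))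
  have hmass : ∀ c : Fin C, ∀ η : ℝ, 0 < η →
      Tendsto (fun N : ℕ => rejuvenatedLaw K (M N) (ν N)
          {x | η ≤ |weightMass (k N) τ x (comp c) - meanFieldMap (τ / (p : ℝ))
            (fun a => vol p (comp a) / vol p (feasibleSet h g)) α c|}) atTop (𝓝 0) := by
    intro c η hη
    -- The probability under the product law plus the total variation distance bounds the
    -- probability under the rejuvenated law.
    have h1 := (hu.tendsto_pi_weightMass hp hV hk hkN hαpos hlab' hC hS c hτ hη).add hmix.mixes
    rw [add_zero] at h1
    refine tendsto_of_tendsto_of_tendsto_of_le_of_le tendsto_const_nhds h1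
      (fun N => zero_le) fun N => measure_le_add_tvDist _ _ ?_
    exact measurableSet_le measurable_const
      ((measurable_weightMass (k N) τ (hu.closed c).measurableSet).sub_const _).abs
  refine ⟨fun c η hη => ?_, hmass, fun c η hη =>
    tendsto_lintegral_resampleLaw (hu.closed c).measurableSet (hmass c) hη⟩
  rw [ENNReal.tendsto_nhds_zero]
  intro ε hε
  have hε2 : 0 < ε / 2 := ENNReal.half_pos hε.ne'
  -- Both halves of `ε` are independent of `i`, so the bound passes to the supremum.
  filter_upwards [hu.eventually_pi_knnRadius_le hp hV hk hkN hαpos hlab' c hη hε2,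
    hmix.mixes.eventually (ge_mem_nhds hε2)] with N hN htv
  refine iSup₂_le fun i hi => (measure_le_add_tvDist _ _ ?_).trans
    ((add_le_add (hN i hi) htv).trans_eq (ENNReal.add_halves ε))
  exact measurableSet_le measurable_const
    (((measurable_knnRadius (k N) i).div_const _).sub_const 1).abs
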